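/- Parameters: integers $L\ge 0$ (files $1,\dots,L$), $M\ge 1$ (groups), $B_B\ge 0$ (backhaul capacity), $q_l\in\{0,\dots,M\}$ for each file $l$; reals $\lambda^b>0$, $W>0$, $\tau>0$, $\alpha>2$. Network. Base stations (BSs) form a homogeneous Poisson point process of density $\lambda^b$ in $\mathbb R^2$; each BS independently joins one of the groups $0,\dots,M-1$ uniformly at random. BS $n$ is at distance $D_n$ from the typical user at the origin, with channel coefficient $h_n$; the $h_n$ are i.i.d. $\mathcal{CN}(0,1)$ (Rayleigh fading), and positions, groups and fading are independent. File $l$ is cached by the groups in $$\mathcal M_l=\Big\{\Big(\sum_{l'<l}q_{l'}+j\Big)\bmod M:\ 0\le j<q_l\Big\}.$$ If the typical user requests file $l$, its serving BS $B_0$ is the nearest BS among those whose group lies in $\mathcal M_l$ if $q_l\ne0$, and the nearest of all BSs if $q_l=0$. Traffic. Let $L_0$ be the file requested by the typical user, $\mathbf K=(K_1,\dots,K_L)$ the BS loading vector of $B_0$ ($K_l$ users of $B_0$, the typical user included, request file $l$), and $S\in\{0,1\}$ the scheduling state: $S=1$ if $q_{L_0}\ne 0$ or if the typical user is among the first $B_B$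 users in a uniformly random order of the $\sum_{l:q_l=0}K_l$ users of $B_0$ requesting uncached files. The request $L_0$ is independent of the network (positions, groups, fading), and, given $L_0$ and the group of $B_0$, the pair ($\mathbf K$, random order) is independent of the network. With $m_0$ the group of $B_0$, set $$\mathrm{SIR}=\frac{D_{B_0}^{-\alpha}|h_{B_0}|^2}{\sum_{n\ne B_0,\ n\text{ in group }m_0}D_n^{-\alpha}|h_n|^2},\qquad C=\frac{W}{MG_0}\log_2(1+\mathrm{SIR}),\qquad G_0=\sum_{l:q_l\neq0}K_l+\min\Big\{\sum_{l:q_l=0}K_l,\,B_B\Big\}.$$ Claim. For every $\mathbf k$ and $l_0$ with $\Pr[\mathbf K=\mathbf k,L_0=l_0,S=1]>0$, $$\Pr[C\ge\tau\mid\mathbf K=\mathbf k,L_0=l_0,S=1]=\frac{\lambda^b_{l_0}/\lambda^b_I}{\lambda^b_{l_0}/\lambda^b_I+\beta(M,g_0)},$$ where $g_0=\sum_{l:q_l\ne0}k_l+\min\{\sum_{l:q_l=0}k_l,B_B\}$, $\lambda^b_I=\lambda^b/M$, $\lambda^b_{l_0}=\lambda^b$ if $q_{l_0}=0$ and $\lambda^b_{l_0}=\frac{q_{l_0}}{M}\lambda^b$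 otherwise, $$\beta(M,g_0)=\frac2\alpha\Big(2^{Mg_0\tau/W}-1\Big)^{2/\alpha}B'\Big(\frac2\alpha,1-\frac2\alpha,2^{-Mg_0\tau/W}\Big),\qquad B'(x,y,z)=\int_z^1u^{x-1}(1-u)^{y-1}\,\mathrm du.$$ -/

import Mathlib

open MeasureTheory ProbabilityTheory

noncomputable section

namespace CachedNetwork

/-- The Euclidean plane; the typical user sits at its origin. -/
abbrev Plane : Type := EuclideanSpace ℝ (Fin 2)

/-- The number (possibly infinite) of points of the sequence `x` that lie in `B`. -/
def pointCount (x : ℕ → Plane) (B : Set Plane) : ℕ∞ :=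
  {n : ℕ | x n ∈ B}.encard

/-- The random points `X 0, X 1, …` enumerate a homogeneous Poisson point process of density `lam`
on the plane: the number of points in a Borel set `B` of finite area is Poisson distributed with
mean `lam * area B`, and the numbers of points in disjoint such sets are independent. -/
structure IsHomogeneousPPP {Ω : Type*} [MeasurableSpace Ω] (P : Measure Ω) (lam : ℝ)
    (X : ℕ → Ω → Plane) : Prop where
  measurable : ∀ n, Measurable (X n)
  count_law : ∀ B : Set Plane, MeasurableSet B → volume B < ⊤ → ∀ j : ℕ,
    P {ω | pointCount (fun n => X n ω) B = (j : ℕ∞)} =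
      ENNReal.ofReal (Real.exp (-(lam * volume.real B)) * (lam * volume.real B) ^ j /
        (j.factorial : ℝ))
  count_indep : ∀ (r : ℕ) (B : Fin r → Set Plane), (∀ i, MeasurableSet (B i)) →
    (∀ i, volume (B i) < ⊤) → Pairwise (fun i i' => Disjoint (B i) (B i')) →
    iIndepFun (fun i ω => pointCount (fun n => X n ω) (B i)) P

/-- The circularly symmetric complex normal law `CN(0,1)`: independent real and imaginary parts,
each a centred Gaussian of variance `1/2`. -/
def complexNormal : Measure ℂ :=
  ((gaussianReal 0 (1 / 2)).prod (gaussianReal 0 (1 / 2))).map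
    Complex.measurableEquivRealProd.symm

/-- The base stations: `X n` is the position of the `n`-th one, `grp n` the group (and subband)
it joins, `h n` the coefficient of its small-scale fading channel to the typical user.
The positions form a Poisson process of density `lam`, every base station joins one of the `M`
groups uniformly at random, the channels are Rayleigh fading, and all of this is independent. -/
structure IsNetwork {Ω : Type*} [MeasurableSpace Ω] (P : Measure Ω) (lam : ℝ) {M : ℕ}
    (X : ℕ → Ω → Plane) (grp : ℕ → Ω → Fin M) (h : ℕ → Ω → ℂ) : Prop where
  position_ppp : IsHomogeneousPPP P lam X
  grp_measurable : ∀ n, Measurable (grp n)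
  grp_uniform : ∀ n m, P {ω | grp n ω = m} = (M : ENNReal)⁻¹
  grp_iIndep : iIndepFun grp P
  fading_measurable : ∀ n, Measurable (h n)
  fading_law : ∀ n, P.map (h n) = complexNormal
  fading_iIndep : iIndepFun h P
  grp_fading_indep : IndepFun (fun ω n => grp n ω) (fun ω n => h n ω) P
  position_marks_indep : IndepFun (fun ω n => X n ω) (fun ω n => (grp n ω, h n ω)) P

/-- The groups whose caches hold file `l`: the residues modulo `M` of
`s, s + 1, …, s + q l - 1`, where `s` is the sum of `q l'` over the files `l'` before `l`. -/
def cacheGroups {L : ℕ} (M : ℕ) (q : Fin L → ℕ) (l : Fin L) : Finset (Fin M) :=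
  {m | ∃ j ∈ Finset.range (q l), (m : ℕ) = ((∑ l' with l' < l, q l') + j) % M}

/-- A base station of group `m` has access to file `l`: it caches the file, or the file is in no
cache and is fetched over the backhaul. -/
def HasAccess {L M : ℕ} (q : Fin L → ℕ) (l : Fin L) (m : Fin M) : Prop :=
  q l = 0 ∨ m ∈ cacheGroups M q l

/-- Base station `n` is a nearest one to the origin among those with access to file `l`. -/
def IsNearest {L M : ℕ} (q : Fin L → ℕ) (l : Fin L) (x : ℕ → Plane) (g : ℕ → Fin M) (n : ℕ) :
    Prop :=
  HasAccess q l (g n) ∧ ∀ n', HasAccess q l (g n') → ‖x n‖ ≤ ‖x n'‖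

/-- The (index of the) serving base station of the typical user when it requests file `l`.
The nearest base station with access exists and is unique with probability one. -/
def servingBS {L M : ℕ} (q : Fin L → ℕ) (l : Fin L) (x : ℕ → Plane) (g : ℕ → Fin M) : ℕ :=
  sInf {n | IsNearest q l x g n}

/-- The group (and subband) of the serving base station. -/
def servingGroup {L M : ℕ} (q : Fin L → ℕ) (l : Fin L) (x : ℕ → Plane) (g : ℕ → Fin M) : Fin M :=
  g (servingBS q l x g)

open Classical in
/-- Interference at the typical user when it is served by base station `b`: the received power
from the other base stations of the group of `b` (finite with probability one if `2 < α`). -/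
def interference {M : ℕ} (α : ℝ) (x : ℕ → Plane) (g : ℕ → Fin M) (h : ℕ → ℂ) (b : ℕ) : ENNReal :=
  ∑' n, if n ≠ b ∧ g n = g b then ENNReal.ofReal (‖x n‖ ^ (-α) * ‖h n‖ ^ 2) else 0

/-- Signal-to-interference ratio of the typical user when it is served by base station `b`. -/
def sir {M : ℕ} (α : ℝ) (x : ℕ → Plane) (g : ℕ → Fin M) (h : ℕ → ℂ) (b : ℕ) : ℝ :=
  (‖x b‖ ^ (-α) * ‖h b‖ ^ 2) / (interference α x g h b).toReal

/-- The number of users that the serving base station serves simultaneously, for the loading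
vector `k` and backhaul capacity `BB`. -/
def servedUsers {L : ℕ} (q : Fin L → ℕ) (BB : ℕ) (k : Fin L → ℕ) : ℕ :=
  (∑ l with q l ≠ 0, k l) + min (∑ l with q l = 0, k l) BB

/-- Achievable rate of the typical user when it requests file `l` and the loading vector of its
serving base station is `k`. -/
def achievableRate {L M : ℕ} (q : Fin L → ℕ) (BB : ℕ) (W α : ℝ) (k : Fin L → ℕ) (l : Fin L)
    (x : ℕ → Plane) (g : ℕ → Fin M) (h : ℕ → ℂ) : ℝ :=
  W / ((M : ℝ) * (servedUsers q BB k : ℝ)) *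
    Real.logb 2 (1 + sir α x g h (servingBS q l x g))

/-- Traffic at the serving base station of the typical user. `K · l` is the number of its users
that request file `l`, `L₀` is the request of the typical user (who is counted in `K · L₀`), and
`J` is the place of the typical user in a uniformly random order of the users whose files have to
come over the backhaul (relevant only if the typical user is one of them). -/
structure IsTraffic {Ω : Type*} [MeasurableSpace Ω] (P : Measure Ω) {L : ℕ} (q : Fin L → ℕ)
    (K : Ω → Fin L → ℕ) (L₀ : Ω → Fin L) (J : Ω → ℕ) : Prop where
  loading_measurable : Measurable K
  request_measurable : Measurable L₀
  rank_measurable : Measurable J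
  user_counted : ∀ᵐ ω ∂P, 1 ≤ K ω (L₀ ω)
  rank_uniform : ∀ (k : Fin L → ℕ) (l : Fin L), q l = 0 → ∀ j < ∑ l' with q l' = 0, k l',
    P {ω | K ω = k ∧ L₀ ω = l ∧ J ω = j} =
      P {ω | K ω = k ∧ L₀ ω = l} / ((∑ l' with q l' = 0, k l' : ℕ) : ENNReal)

/-- How traffic and radio environment are coupled: the request of the typical user is independent of
the base stations and channels, and given this request and the group of the serving base station,
the loading and the random backhaul order are independent of the base stations and channels. -/
structure IsDecoupled {Ω : Type*} [MeasurableSpace Ω] (P : Measure Ω) {L M : ℕ} (q : Fin L → ℕ)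
    (X : ℕ → Ω → Plane) (grp : ℕ → Ω → Fin M) (h : ℕ → Ω → ℂ)
    (K : Ω → Fin L → ℕ) (L₀ : Ω → Fin L) (J : Ω → ℕ) : Prop where
  request_indep :
    IndepFun (fun ω => ((fun n => X n ω), (fun n => grp n ω), (fun n => h n ω))) L₀ P
  traffic_condIndep : ∀ A : Set ((ℕ → Plane) × (ℕ → Fin M) × (ℕ → ℂ)), MeasurableSet A →
    ∀ (m : Fin M) (l : Fin L) (k : Fin L → ℕ) (j : ℕ),
    P {ω | ((fun n => X n ω), (fun n => grp n ω), (fun n => h n ω)) ∈ A ∧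
        servingGroup q (L₀ ω) (fun n => X n ω) (fun n => grp n ω) = m ∧ L₀ ω = l ∧
        K ω = k ∧ J ω = j} *
      P {ω | servingGroup q (L₀ ω) (fun n => X n ω) (fun n => grp n ω) = m ∧ L₀ ω = l} =
    P {ω | ((fun n => X n ω), (fun n => grp n ω), (fun n => h n ω)) ∈ A ∧
        servingGroup q (L₀ ω) (fun n => X n ω) (fun n => grp n ω) = m ∧ L₀ ω = l} *
      P {ω | servingGroup q (L₀ ω) (fun n => X n ω) (fun n => grp n ω) = m ∧ L₀ ω = l ∧
        K ω = k ∧ J ω = j}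

/-- The user with request `l` and place `j` in the backhaul order is scheduled: its file is cached,
or it is among the first `BB` users in that order. -/
def IsScheduled {L : ℕ} (q : Fin L → ℕ) (BB : ℕ) (l : Fin L) (j : ℕ) : Prop :=
  q l ≠ 0 ∨ j < BB

/-- Complementary incomplete Beta function. -/
def compIncBeta (x y z : ℝ) : ℝ :=
  ∫ u in z..1, u ^ (x - 1) * (1 - u) ^ (y - 1)

/-- The coefficient `β(M, g₀)`. -/
def betaCoeff (W τ α : ℝ) (M g₀ : ℕ) : ℝ :=
  2 / α * ((2 : ℝ) ^ ((M : ℝ) * g₀ * τ / W) - 1) ^ (2 / α) *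
    compIncBeta (2 / α) (1 - 2 / α) ((2 : ℝ) ^ (-((M : ℝ) * g₀ * τ / W)))

/-- Density of the base stations that have access to file `l`. -/
def accessDensity {L : ℕ} (lam : ℝ) (M : ℕ) (q : Fin L → ℕ) (l : Fin L) : ℝ :=
  if q l = 0 then lam else (q l : ℝ) / (M : ℝ) * lam

/-- Density of the base stations in one subband. -/
def interfererDensity (lam : ℝ) (M : ℕ) : ℝ :=
  lam / (M : ℝ)

end CachedNetwork

end

/-! Let `A` be the set of groups with access to the requested file, `m ∈ A`, and `T = 2 ^ (M g₀ τ /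
W) - 1`, so that the rate reaches `τ` exactly when the signal-to-interference ratio reaches `T`. The
core is that the serving group is `m` and the ratio reaches `T` with probability `1 / (|A| + β)`,
the same for every `m ∈ A` (`IsNetwork.measure_iUnion_coverEvent`).

This event is a disjoint union over the possible serving stations `b`. Fix the positions. The powers
`|h n|²` are independent unit exponentials, so given the groups the signal of `b` dominates with
probability `∏ 1 / (1 + s n)`, where `s n` is the relative strength of interferer `n`
(`fading_infinite`). The groups are independent too, so averaging over them keeps a product: `1 / M`
times the product over `n ≠ b` of `v (‖x n‖ / ‖x b‖)` (`IsNetwork.measure_coverEvent_fixed`). Here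
`v = coverProfile` is `1 - |A| / M` up to distance ratio `1` (no nearer station may have access) and
`1 - (1 / M) T / (T + u ^ α)` beyond.

Since `v` sees only ratios of distances, the Campbell–Mecke formula with the Poisson Laplace
functional turns the expected sum over `b` into `∫ lam exp (-lam I ‖x‖²) dx = π / I`, with `I = ∫ (1
- v ‖x‖) dx`; the density cancels (`IsHomogeneousPPP.lintegral_tsum_relativeProd`). This is proved
by slicing the plane into thin geometric annuli, squeezing between two bounds, and letting the ratio
of the radii tend to `1`. Radial integration gives `I = π (|A| + β) / M`, and a substitution
identifies `β` with the incomplete Beta expression (`betaCoeff_eq`).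

At `T = 0` the same formula says that each group of `A` serves with probability `1 / |A|`. The
conditional coverage probability given the serving group is therefore `|A| / (|A| + β)` for every
group. Because the traffic is decoupled from the network given request and serving group, further
conditioning on the traffic does not alter it (`measure_traffic_coverage`), and summing over groups
and backhaul ranks proves the theorem, as `|A|` is the ratio of the two densities. -/

noncomputable section

namespace CachedNetwork

open Filter Topology Set
open scoped ENNReal

/-! ### Infinite products of factors in `[0, 1]` -/

/-- The infinite product of a sequence with values in `[0, 1]`, as the infimum of its partial
products. -/
def infProd (y : ℕ → ℝ≥0∞) : ℝ≥0∞ := ⨅ N, ∏ n ∈ Finset.range N, y n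

lemma antitone_partialProd {y : ℕ → ℝ≥0∞} (hy : ∀ n, y n ≤ 1) :
    Antitone fun N => ∏ n ∈ Finset.range N, y n := by
  refine antitone_nat_of_succ_le fun N => ?_
  rw [Finset.prod_range_succ]
  exact mul_le_of_le_one_right' (hy N)

lemma tendsto_infProd {y : ℕ → ℝ≥0∞} (hy : ∀ n, y n ≤ 1) :
    Tendsto (fun N => ∏ n ∈ Finset.range N, y n) atTop (𝓝 (infProd y)) :=
  tendsto_atTop_iInf (antitone_partialProd hy)

lemma infProd_mono {y z : ℕ → ℝ≥0∞} (h : ∀ n, y n ≤ z n) : infProd y ≤ infProd z :=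
  iInf_mono fun _ => Finset.prod_le_prod' fun n _ => h n

lemma infProd_le_one (y : ℕ → ℝ≥0∞) : infProd y ≤ 1 :=
  (iInf_le _ 0).trans (by simp)

lemma infProd_mul {y z : ℕ → ℝ≥0∞} (hy : ∀ n, y n ≤ 1) (hz : ∀ n, z n ≤ 1) :
    infProd (fun n => y n * z n) = infProd y * infProd z := by
  have h1 := tendsto_infProd (y := fun n => y n * z n) fun n => mul_le_one' (hy n) (hz n)
  have h2 := ENNReal.Tendsto.mul (tendsto_infProd hy)
    (Or.inr (ne_top_of_le_ne_top ENNReal.one_ne_top (infProd_le_one z))) (tendsto_infProd hz)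
    (Or.inr (ne_top_of_le_ne_top ENNReal.one_ne_top (infProd_le_one y)))
  simp only [← Finset.prod_mul_distrib] at h2
  exact tendsto_nhds_unique h1 h2

lemma infProd_single (b : ℕ) {c : ℝ≥0∞} (hc : c ≤ 1) :
    infProd (fun n => if n = b then c else 1) = c := by
  refine le_antisymm ((iInf_le _ (b + 1)).trans ?_) (le_iInf fun N => ?_)
  · simp [Finset.prod_ite_eq']
  · rw [Finset.prod_ite_eq']
    split_ifs <;> simp [hc]

lemma infProd_eq_zero {y : ℕ → ℝ≥0∞} {n : ℕ} (h : y n = 0) : infProd y = 0 :=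
  le_antisymm ((iInf_le _ (n + 1)).trans_eq
    (Finset.prod_eq_zero (Finset.mem_range.2 n.lt_succ_self) h)) bot_le

lemma measurable_infProd {Ω : Type*} [MeasurableSpace Ω] {Y : ℕ → Ω → ℝ≥0∞}
    (hY : ∀ n, Measurable (Y n)) : Measurable fun ω => infProd fun n => Y n ω :=
  Measurable.iInf fun N => Finset.measurable_fun_prod (Finset.range N) fun n _ => hY n

/-- Antitone limits of the factors pass to the infinite product. -/
lemma iInf_infProd {y : ℕ → ℕ → ℝ≥0∞} (h1 : ∀ k n, y k n ≤ 1) (ha : Antitone y) :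
    ⨅ k, infProd (y k) = infProd fun n => ⨅ k, y k n := by
  unfold infProd
  rw [iInf_comm]
  refine iInf_congr fun N => ?_
  have hanti : Antitone fun k => ∏ n ∈ Finset.range N, y k n :=
    fun k k' hk => Finset.prod_le_prod' fun n _ => ha hk n
  refine tendsto_nhds_unique (tendsto_atTop_iInf hanti) ?_
  refine ENNReal.tendsto_finsetProd_of_ne_top _ (fun n _ => ?_) fun n _ => ?_
  · exact tendsto_atTop_iInf fun k k' hk => ha hk n
  · exact ne_top_of_le_ne_top ENNReal.one_ne_top ((iInf_le _ 0).trans (h1 0 n))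

/-- The expectation of an infinite product of independent factors in `[0, 1]`. -/
lemma lintegral_infProd {Ω : Type*} [MeasurableSpace Ω] {P : Measure Ω} {Y : ℕ → Ω → ℝ≥0∞}
    (hY : ∀ n, Measurable (Y n)) (h1 : ∀ n ω, Y n ω ≤ 1) (hind : iIndepFun Y P) :
    ∫⁻ ω, infProd (fun n => Y n ω) ∂P = infProd fun n => ∫⁻ ω, Y n ω ∂P := by
  have := hind.isProbabilityMeasure
  unfold infProd
  rw [lintegral_iInf (fun N => Finset.measurable_fun_prod _ fun n _ => hY n)]
  · exact iInf_congr fun N => lintegral_prod_eq_prod_lintegral_of_indepFun _ _ hind hY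
  · exact fun N N' h ω => antitone_partialProd (fun n => h1 n ω) h
  · simp

/-! ### Rayleigh fading: exponential powers and their comparison -/

/-- The squared modulus of a `CN(0,1)` variable, in polar coordinates. -/
lemma lintegral_complexNormal {F : ℝ → ℝ≥0∞} (hF : Measurable F) :
    ∫⁻ z, F (‖z‖ ^ 2) ∂complexNormal =
      ∫⁻ r in Ioi (0 : ℝ), ENNReal.ofReal (2 * r * Real.exp (-r ^ 2)) * F (r ^ 2) := by
  have hv : (1 / 2 : NNReal) ≠ 0 := by norm_num
  have hpdf : ∀ x, gaussianPDF 0 (1 / 2) x =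
      ENNReal.ofReal ((√Real.pi)⁻¹ * Real.exp (-x ^ 2)) := by
    intro x
    rw [gaussianPDF, gaussianPDFReal]
    have h2 : √(2 * Real.pi * ((1 / 2 : NNReal) : ℝ)) = √Real.pi := by
      congr 1; push_cast; ring
    rw [h2]
    congr 3
    push_cast; ring
  have hFm : Measurable fun z : ℂ => F (‖z‖ ^ 2) := by fun_prop
  unfold complexNormal
  rw [lintegral_map hFm Complex.measurableEquivRealProd.symm.measurable,
    gaussianReal_of_var_ne_zero _ hv, prod_withDensity (by fun_prop) (by fun_prop),
    lintegral_withDensity_eq_lintegral_mul _ (by fun_prop)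
      (show Measurable fun a => F (‖Complex.measurableEquivRealProd.symm a‖ ^ 2) from
        hFm.comp Complex.measurableEquivRealProd.symm.measurable)]
  have hnorm : ∀ p : ℝ × ℝ, ‖Complex.measurableEquivRealProd.symm p‖ ^ 2 = p.1 ^ 2 + p.2 ^ 2 := by
    intro p
    rw [← Complex.normSq_eq_norm_sq, Complex.normSq_apply]
    simp [Complex.measurableEquivRealProd_symm_apply]
    ring
  have hint : ∀ p : ℝ × ℝ, ((fun z : ℝ × ℝ => gaussianPDF 0 (1 / 2) z.1 * gaussianPDF 0 (1 / 2) z.2)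
      * fun a => F (‖Complex.measurableEquivRealProd.symm a‖ ^ 2)) p =
      ENNReal.ofReal (Real.pi⁻¹ * Real.exp (-(p.1 ^ 2 + p.2 ^ 2))) * F (p.1 ^ 2 + p.2 ^ 2) := by
    intro p
    rw [Pi.mul_apply, hnorm, hpdf, hpdf, ← ENNReal.ofReal_mul (by positivity)]
    congr 2
    rw [neg_add, Real.exp_add]
    have : Real.pi⁻¹ = (√Real.pi)⁻¹ * (√Real.pi)⁻¹ := by
      rw [← mul_inv, Real.mul_self_sqrt Real.pi_pos.le]
    rw [this]; ring
  simp_rw [hint]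
  change ∫⁻ p : ℝ × ℝ, _ = _
  rw [← lintegral_comp_polarCoord_symm]
  have hcs : ∀ p : ℝ × ℝ, (polarCoord.symm p).1 ^ 2 + (polarCoord.symm p).2 ^ 2 = p.1 ^ 2 := by
    intro p
    simp only [polarCoord_symm_apply]
    nlinarith [Real.sin_sq_add_cos_sq p.2]
  simp_rw [hcs]
  rw [polarCoord_target, Measure.volume_eq_prod, ← Measure.prod_restrict,
    lintegral_prod _ (by fun_prop)]
  refine setLIntegral_congr_fun measurableSet_Ioi fun r hr => ?_
  have hr : 0 < r := hr
  simp only [smul_eq_mul, lintegral_const, Measure.restrict_apply MeasurableSet.univ, univ_inter,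
    Real.volume_Ioo]
  rw [mul_comm, ← mul_assoc, ← mul_assoc, ← ENNReal.ofReal_mul (by linarith [Real.pi_pos]),
    ← ENNReal.ofReal_mul (mul_nonneg (by linarith [Real.pi_pos]) hr.le)]
  congr 2
  field_simp
  ring

/-- In polar coordinates the integrand has an elementary antiderivative. Taking `s = 0` gives the
exponential tail of the received power, and `t = 0` gives its Laplace transform. -/
lemma lintegral_complexNormal_exp {s t : ℝ} (hs : 0 ≤ s) (ht : 0 ≤ t) :
    ∫⁻ z, (if t ≤ ‖z‖ ^ 2 then ENNReal.ofReal (Real.exp (-(s * ‖z‖ ^ 2))) else 0) ∂complexNormal =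
      ENNReal.ofReal (Real.exp (-((1 + s) * t)) / (1 + s)) := by
  rw [lintegral_complexNormal
    (F := fun x => if t ≤ x then ENNReal.ofReal (Real.exp (-(s * x))) else 0)
    (Measurable.ite measurableSet_Ici (by fun_prop) measurable_const)]
  have hs1 : 0 < 1 + s := by linarith
  set G : ℝ → ℝ := fun r => -(Real.exp (-((1 + s) * r ^ 2)) / (1 + s)) with hG
  have hderiv : ∀ r : ℝ, HasDerivAt G (2 * r * Real.exp (-((1 + s) * r ^ 2))) r := by
    intro r
    have h1 : HasDerivAt (fun r : ℝ => -((1 + s) * r ^ 2)) (-((1 + s) * (2 * r))) r := by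
      have h0 := ((hasDerivAt_pow 2 r).const_mul (1 + s)).neg
      simp only [Nat.cast_ofNat, Nat.add_one_sub_one, pow_one] at h0
      exact h0
    have h2 := (h1.exp.div_const (1 + s)).neg
    have h3 : 2 * r * Real.exp (-((1 + s) * r ^ 2)) =
        -(Real.exp (-((1 + s) * r ^ 2)) * -((1 + s) * (2 * r)) / (1 + s)) := by
      field_simp
    rw [h3]
    exact h2
  have hlim : Tendsto G atTop (𝓝 0) := by
    have h1 : Tendsto (fun r : ℝ => (1 + s) * r ^ 2) atTop atTop :=
      (tendsto_pow_atTop two_ne_zero).const_mul_atTop hs1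
    have := ((Real.tendsto_exp_neg_atTop_nhds_zero.comp h1).div_const (1 + s)).neg
    simpa [hG, Function.comp_def] using this
  have hnn : ∀ r ∈ Ioi (√t), 0 ≤ 2 * r * Real.exp (-((1 + s) * r ^ 2)) := by
    intro r hr
    have : 0 ≤ r := (Real.sqrt_nonneg t).trans (le_of_lt hr)
    positivity
  have hval := integral_Ioi_of_hasDerivAt_of_nonneg' (a := √t) (fun r _ => hderiv r) hnn hlim
  have hintg := integrableOn_Ioi_deriv_of_nonneg' (a := √t) (fun r _ => hderiv r) hnn hlim
  have hGt : 0 - G (√t) = Real.exp (-((1 + s) * t)) / (1 + s) := by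
    simp [hG, Real.sq_sqrt ht]
  rw [← hGt, ← hval, ofReal_integral_eq_lintegral_ofReal hintg
    ((ae_restrict_iff' measurableSet_Ioi).2 (ae_of_all _ hnn)),
    ← lintegral_indicator measurableSet_Ioi, ← lintegral_indicator measurableSet_Ioi]
  -- The cutoff `t ≤ r ^ 2` is closed while `Ioi (√t)` is open; they differ in one point, a null
  -- set.
  have hne : ∀ᵐ r : ℝ, r ≠ √t := by simp [ae_iff]
  refine lintegral_congr_ae ?_
  filter_upwards [hne] with r hr
  by_cases h : r ∈ Ioi (√t)
  · have h0 : 0 < r := (Real.sqrt_nonneg t).trans_lt h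
    have hle : t ≤ r ^ 2 := by
      rw [← Real.sq_sqrt ht]; exact pow_le_pow_left₀ (Real.sqrt_nonneg t) (le_of_lt h) 2
    rw [indicator_of_mem (show r ∈ Ioi 0 from h0), indicator_of_mem h, if_pos hle,
      ← ENNReal.ofReal_mul (by positivity), mul_assoc, ← Real.exp_add]
    ring_nf
  · rw [indicator_of_notMem h]
    by_cases h0 : r ∈ Ioi (0 : ℝ)
    · have hlt : r < √t := lt_of_le_of_ne (not_lt.1 h) hr
      rw [indicator_of_mem h0, if_neg, mul_zero]
      rw [not_le, ← Real.sq_sqrt ht]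
      exact pow_lt_pow_left₀ hlt (le_of_lt h0) two_ne_zero
    · rw [indicator_of_notMem h0]

section Fading

variable {Ω : Type*} [MeasurableSpace Ω] {P : Measure Ω} {h : ℕ → Ω → ℂ}

lemma fading_tail (hm : ∀ n, Measurable (h n)) (hlaw : ∀ n, P.map (h n) = complexNormal)
    (n : ℕ) {t : ℝ} (ht : 0 ≤ t) :
    P {ω | t ≤ ‖h n ω‖ ^ 2} = ENNReal.ofReal (Real.exp (-t)) := by
  have hms : MeasurableSet {z : ℂ | t ≤ ‖z‖ ^ 2} := measurableSet_le (by fun_prop) (by fun_prop)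
  have h0 := lintegral_complexNormal_exp le_rfl ht
  simp only [zero_mul, neg_zero, Real.exp_zero, ENNReal.ofReal_one, add_zero, one_mul,
    div_one] at h0
  rw [← h0, ← hlaw n]
  change P (h n ⁻¹' {z : ℂ | t ≤ ‖z‖ ^ 2}) = _
  rw [← Measure.map_apply (hm n) hms, ← lintegral_indicator_one hms]
  rfl

lemma fading_laplace (hm : ∀ n, Measurable (h n)) (hlaw : ∀ n, P.map (h n) = complexNormal)
    (n : ℕ) {s : ℝ} (hs : 0 ≤ s) :
    ∫⁻ ω, ENNReal.ofReal (Real.exp (-(s * ‖h n ω‖ ^ 2))) ∂P = ENNReal.ofReal (1 / (1 + s)) := by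
  have h0 := lintegral_complexNormal_exp hs le_rfl
  simp only [sq_nonneg, if_true, mul_zero, neg_zero, Real.exp_zero] at h0
  rw [← h0, ← hlaw n, lintegral_map (by fun_prop) (hm n)]

/-- Conditionally on the interferers, the exponential tail of the signal at their weighted sum is a
product of exponentials, one for each interferer. By independence the mean factors into Laplace
transforms. -/
lemma fading_finite (hm : ∀ n, Measurable (h n)) (hlaw : ∀ n, P.map (h n) = complexNormal)
    (hind : iIndepFun h P) {s : ℕ → ℝ} (hs : ∀ n, 0 ≤ s n) {b : ℕ} {S : Finset ℕ} (hb : b ∉ S) :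
    P {ω | ∑ n ∈ S, s n * ‖h n ω‖ ^ 2 ≤ ‖h b ω‖ ^ 2} =
      ∏ n ∈ S, ENNReal.ofReal (1 / (1 + s n)) := by
  have := hind.isProbabilityMeasure
  -- Weight `1` at `b` puts the signal and the weighted interferers into one independent family.
  set f : ℕ → Ω → ℝ := fun n ω => (if n = b then 1 else s n) * ‖h n ω‖ ^ 2 with hf
  have hfm : ∀ n, Measurable (f n) := fun n => by have := hm n; fun_prop
  have hfind : iIndepFun f P :=
    hind.comp (fun n (z : ℂ) => (if n = b then 1 else s n) * ‖z‖ ^ 2) fun n => by fun_prop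
  have hZ : ∀ ω, (∑ n ∈ S, f n) ω = ∑ n ∈ S, s n * ‖h n ω‖ ^ 2 := by
    intro ω
    rw [Finset.sum_apply]
    refine Finset.sum_congr rfl fun n hn => ?_
    have : n ≠ b := fun h => hb (h ▸ hn)
    simp [hf, this]
  have hI := hfind.indepFun_finsetSum_of_notMem hfm hb
  have hZm : Measurable (∑ n ∈ S, f n) := by
    rw [Finset.sum_fn]
    exact Finset.measurable_fun_sum _ fun n _ => hfm n
  have hle : MeasurableSet {p : ℝ × ℝ | p.1 ≤ p.2} := measurableSet_le measurable_fst measurable_snd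
  have hset : {ω | ∑ n ∈ S, s n * ‖h n ω‖ ^ 2 ≤ ‖h b ω‖ ^ 2} =
      (fun ω => ((∑ n ∈ S, f n) ω, f b ω)) ⁻¹' {p : ℝ × ℝ | p.1 ≤ p.2} := by
    ext ω
    simp only [mem_ofPred_eq, mem_preimage, hZ]
    simp [hf]
  rw [hset, ← Measure.map_apply (hZm.prodMk (hfm b)) hle,
    (indepFun_iff_map_prod_eq_prod_map_map hZm.aemeasurable (hfm b).aemeasurable).1 hI,
    Measure.prod_apply hle, lintegral_map (measurable_measure_prodMk_left hle) hZm]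
  have hstep : ∀ ω, P.map (f b) (Prod.mk ((∑ n ∈ S, f n) ω) ⁻¹' {p : ℝ × ℝ | p.1 ≤ p.2}) =
      ∏ n ∈ S, ENNReal.ofReal (Real.exp (-(s n * ‖h n ω‖ ^ 2))) := by
    intro ω
    rw [Measure.map_apply (hfm b) (measurable_prodMk_left hle), hZ]
    have h0 : 0 ≤ ∑ n ∈ S, s n * ‖h n ω‖ ^ 2 :=
      Finset.sum_nonneg fun n _ => mul_nonneg (hs n) (sq_nonneg _)
    have := fading_tail hm hlaw b h0
    simp only [hf, preimage, mem_ofPred_eq, if_true, one_mul]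
    rw [this, ← Finset.sum_neg_distrib, Real.exp_sum,
      ENNReal.ofReal_prod_of_nonneg fun n _ => (Real.exp_pos _).le]
  simp_rw [hstep]
  rw [lintegral_prod_eq_prod_lintegral_of_indepFun S
    (fun n ω => ENNReal.ofReal (Real.exp (-(s n * ‖h n ω‖ ^ 2))))
    (hind.comp (fun n (z : ℂ) => ENNReal.ofReal (Real.exp (-(s n * ‖z‖ ^ 2)))) fun n => by fun_prop)
    (fun n => by have := hm n; fun_prop)]
  exact Finset.prod_congr rfl fun n _ => fading_laplace hm hlaw n (hs n)

/-- The probability that an exponential signal exceeds a weighted sum of exponential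
interferers. -/
lemma fading_infinite (hm : ∀ n, Measurable (h n)) (hlaw : ∀ n, P.map (h n) = complexNormal)
    (hind : iIndepFun h P) {s : ℕ → ℝ} (hs : ∀ n, 0 ≤ s n) (b : ℕ) :
    P {ω | ∑' n, (if n = b then 0 else ENNReal.ofReal (s n * ‖h n ω‖ ^ 2)) ≤
        ENNReal.ofReal (‖h b ω‖ ^ 2)} =
      infProd fun n => if n = b then 1 else ENNReal.ofReal (1 / (1 + s n)) := by
  have := hind.isProbabilityMeasure
  have hpart : ∀ N ω, ∑ n ∈ Finset.range N,
      (if n = b then 0 else ENNReal.ofReal (s n * ‖h n ω‖ ^ 2)) =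
      ENNReal.ofReal (∑ n ∈ (Finset.range N).erase b, s n * ‖h n ω‖ ^ 2) := by
    intro N ω
    rw [ENNReal.ofReal_sum_of_nonneg fun n _ => mul_nonneg (hs n) (sq_nonneg _),
      ← Finset.filter_ne', Finset.sum_filter]
    exact Finset.sum_congr rfl fun n _ => by split_ifs <;> simp_all
  have hset : {ω | ∑' n, (if n = b then 0 else ENNReal.ofReal (s n * ‖h n ω‖ ^ 2)) ≤
        ENNReal.ofReal (‖h b ω‖ ^ 2)} =
      ⋂ N, {ω | ∑ n ∈ (Finset.range N).erase b, s n * ‖h n ω‖ ^ 2 ≤ ‖h b ω‖ ^ 2} := by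
    ext ω
    rw [mem_ofPred_eq, ENNReal.tsum_eq_iSup_nat, iSup_le_iff, mem_iInter]
    refine forall_congr' fun N => ?_
    rw [hpart, ENNReal.ofReal_le_ofReal_iff (sq_nonneg _), mem_ofPred_eq]
  rw [hset, Antitone.measure_iInter]
  · refine iInf_congr fun N => ?_
    rw [fading_finite hm hlaw hind hs (Finset.notMem_erase b _), ← Finset.filter_ne',
      Finset.prod_filter]
    exact Finset.prod_congr rfl fun n _ => by split_ifs <;> simp_all
  · intro N N' hN ω hω
    refine le_trans (Finset.sum_le_sum_of_subset_of_nonneg ?_ ?_) (mem_ofPred_eq ▸ hω)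
    · exact Finset.erase_subset_erase _ (Finset.range_mono hN)
    · exact fun n _ _ => mul_nonneg (hs n) (sq_nonneg _)
  · intro N
    refine (measurableSet_le ?_ ?_).nullMeasurableSet
    · exact Finset.measurable_fun_sum _ fun n _ => by have := hm n; fun_prop
    · have := hm b; fun_prop
  · exact ⟨0, measure_ne_top _ _⟩

end Fading

/-! ### Poisson counts and the Laplace functional -/

section Counts

lemma tsum_pow_div_factorial (c : ℝ) :
    ∑' j : ℕ, c ^ j / (j.factorial : ℝ) = Real.exp c := by
  rw [Real.exp_eq_exp_ℝ, NormedSpace.exp_eq_tsum_div]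

lemma toENNReal_pointCount (x : ℕ → Plane) (B : Set Plane) :
    ((pointCount x B : ℕ∞) : ℝ≥0∞) = ∑' n, B.indicator (fun _ => (1 : ℝ≥0∞)) (x n) := by
  rw [pointCount, ← ENNReal.tsum_set_one, tsum_subtype {n | x n ∈ B} fun _ => (1 : ℝ≥0∞)]
  rfl

lemma infProd_ite_of_finite {p : ℕ → Prop} [DecidablePred p] (hp : {n | p n}.Finite) {c : ℝ≥0∞}
    (hc : c ≤ 1) : infProd (fun n => if p n then c else 1) = c ^ {n | p n}.encard.toNat := by
  have h1 := tendsto_infProd (y := fun n => if p n then c else 1) fun n => by split_ifs <;> simp [hc]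
  refine tendsto_nhds_unique h1 (tendsto_const_nhds.congr' ?_)
  obtain ⟨N₀, hN₀⟩ := hp.bddAbove
  filter_upwards [eventually_gt_atTop N₀] with N hN
  have hfil : (Finset.range N).filter p = hp.toFinset := by
    ext n
    simp only [Finset.mem_filter, Finset.mem_range, Finite.mem_toFinset, mem_ofPred_eq,
      and_iff_right_iff_imp]
    exact fun h => (hN₀ h).trans_lt hN
  rw [← Finset.prod_filter, Finset.prod_const, hfil, hp.encard_eq_coe_toFinset_card,
    ENat.toNat_natCast]

lemma infProd_finsetProd {ι : Type*} (s : Finset ι) {y : ι → ℕ → ℝ≥0∞} (hy : ∀ i n, y i n ≤ 1) :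
    infProd (fun n => ∏ i ∈ s, y i n) = ∏ i ∈ s, infProd (y i) := by
  classical
  induction s using Finset.induction_on with
  | empty => simp [infProd]
  | insert i s hi ih =>
    simp only [Finset.prod_insert hi]
    rw [infProd_mul (hy i) fun n => Finset.prod_le_one' fun j _ => hy j n, ih]

end Counts

namespace IsHomogeneousPPP

variable {Ω : Type*} [MeasurableSpace Ω] {P : Measure Ω} {lam : ℝ} {X : ℕ → Ω → Plane}

lemma measurable_pointCount (hX : IsHomogeneousPPP P lam X) {B : Set Plane}
    (hB : MeasurableSet B) : Measurable fun ω => pointCount (fun n => X n ω) B := by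
  have h1 : Measurable fun ω => ((pointCount (fun n => X n ω) B : ℕ∞) : ℝ≥0∞) := by
    simp_rw [toENNReal_pointCount]
    refine Measurable.tsum fun n => ?_
    exact (measurable_const.indicator hB).comp (hX.measurable n)
  rw [ENat.measurable_iff]
  intro j
  convert h1 (measurableSet_singleton (j : ℝ≥0∞)) using 1
  ext ω
  rw [mem_preimage, mem_preimage, mem_singleton_iff, mem_singleton_iff, ← ENat.toENNReal_coe,
    ENat.toENNReal_inj]

/-- The Poisson probabilities add up to one, so counts are almost surely finite. -/
lemma ae_pointCount_ne_top [IsProbabilityMeasure P] (hX : IsHomogeneousPPP P lam X)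
    (hlam : 0 < lam) {B : Set Plane} (hB : MeasurableSet B) (hfin : volume B < ∞) :
    ∀ᵐ ω ∂P, pointCount (fun n => X n ω) B ≠ ⊤ := by
  have hm := hX.measurable_pointCount hB
  set N := fun ω => pointCount (fun n => X n ω) B with hN
  set c := lam * volume.real B with hc
  have hc0 : 0 ≤ c := by positivity
  have hset : {ω | N ω ≠ ⊤} = ⋃ j : ℕ, {ω | N ω = (j : ℕ∞)} := by
    ext ω
    simp only [mem_ofPred_eq, mem_iUnion, ENat.ne_top_iff_exists]
    exact exists_congr fun j => eq_comm
  have hsum : P {ω | N ω ≠ ⊤} = 1 := by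
    rw [hset, measure_iUnion]
    · simp_rw [hN, hX.count_law B hB hfin, ← hc]
      rw [← ENNReal.ofReal_tsum_of_nonneg (fun j => by positivity)]
      · simp_rw [mul_div_assoc]
        rw [tsum_mul_left, tsum_pow_div_factorial,
          ← Real.exp_add]
        simp
      · simp_rw [mul_div_assoc]
        exact (Real.summable_pow_div_factorial c).mul_left _
    · intro i j hij
      rw [Function.onFun, Set.disjoint_left]
      intro ω hi hj
      rw [mem_ofPred_eq] at hi hj
      rw [hi] at hj
      exact hij (by exact_mod_cast hj)
    · intro j
      exact hm (measurableSet_singleton _)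
  exact (prob_compl_eq_zero_iff (hm (MeasurableSet.of_discrete (s := {k | k ≠ ⊤})))).2 hsum

/-- Counts are almost surely finite, so the value of `g` at `⊤` plays no role. -/
lemma lintegral_pointCount [IsProbabilityMeasure P] (hX : IsHomogeneousPPP P lam X)
    (hlam : 0 < lam) {B : Set Plane} (hB : MeasurableSet B) (hfin : volume B < ∞)
    (g : ℕ∞ → ℝ≥0∞) :
    ∫⁻ ω, g (pointCount (fun n => X n ω) B) ∂P = ∑' j : ℕ, g j *
      ENNReal.ofReal (Real.exp (-(lam * volume.real B)) * (lam * volume.real B) ^ j /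
        (j.factorial : ℝ)) := by
  have hm := hX.measurable_pointCount hB
  have hae := hX.ae_pointCount_ne_top hlam hB hfin
  set N := fun ω => pointCount (fun n => X n ω) B with hN
  have hset : ∀ᵐ ω ∂P, g (N ω) = ∑' j : ℕ, {ω | N ω = (j : ℕ∞)}.indicator (fun _ => g j) ω := by
    filter_upwards [hae] with ω hω
    obtain ⟨j, hj⟩ := ENat.ne_top_iff_exists.1 hω
    rw [tsum_eq_single j]
    · rw [indicator_of_mem]
      · rw [hj]
      · exact hj.symm
    · intro i hi
      rw [indicator_of_notMem]
      rw [mem_ofPred_eq, show N ω = j from hj.symm]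
      exact_mod_cast hi.symm
  have hms : ∀ j : ℕ, MeasurableSet {ω | N ω = (j : ℕ∞)} := fun j => hm (measurableSet_singleton _)
  rw [lintegral_congr_ae hset, lintegral_tsum fun j => (measurable_const.indicator (hms j)).aemeasurable]
  refine tsum_congr fun j => ?_
  rw [lintegral_indicator_const (hms j), hN, hX.count_law B hB hfin]

lemma lintegral_count (hX : IsHomogeneousPPP P lam X) [IsProbabilityMeasure P]
    (hlam : 0 < lam) {B : Set Plane} (hB : MeasurableSet B) (hfin : volume B < ∞) :
    ∫⁻ ω, ((pointCount (fun n => X n ω) B : ℕ∞) : ℝ≥0∞) ∂P =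
      ENNReal.ofReal (lam * volume.real B) := by
  rw [hX.lintegral_pointCount hlam hB hfin fun k => (k : ℝ≥0∞)]
  set c := lam * volume.real B with hc
  have hc0 : 0 ≤ c := by positivity
  rw [tsum_eq_zero_add' ENNReal.summable]
  simp only [CharP.cast_eq_zero, ENat.toENNReal_zero, zero_mul, zero_add]
  have hterm : ∀ j : ℕ, (((j + 1 : ℕ) : ℕ∞) : ℝ≥0∞) *
      ENNReal.ofReal (Real.exp (-c) * c ^ (j + 1) / ((j + 1).factorial : ℝ)) =
      ENNReal.ofReal (c * Real.exp (-c) * (c ^ j / (j.factorial : ℝ))) := by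
    intro j
    rw [ENat.toENNReal_coe, ← ENNReal.ofReal_natCast, ← ENNReal.ofReal_mul (by positivity)]
    congr 1
    rw [Nat.factorial_succ]
    push_cast
    have : (j.factorial : ℝ) ≠ 0 := by positivity
    have : (j : ℝ) + 1 ≠ 0 := by positivity
    field_simp
    ring
  simp_rw [hterm]
  rw [← ENNReal.ofReal_tsum_of_nonneg (fun j => by positivity)
    ((Real.summable_pow_div_factorial c).mul_left _), tsum_mul_left,
    tsum_pow_div_factorial, mul_assoc, ← Real.exp_add]
  simp

/-- The probability generating function of a Poisson variable, evaluated at `1 - y`. -/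
lemma lintegral_pow_count (hX : IsHomogeneousPPP P lam X) [IsProbabilityMeasure P]
    (hlam : 0 < lam) {B : Set Plane} (hB : MeasurableSet B) (hfin : volume B < ∞)
    {y : ℝ≥0∞} (hy : y ≤ 1) :
    ∫⁻ ω, (1 - y) ^ (pointCount (fun n => X n ω) B).toNat ∂P =
      ENNReal.ofReal (Real.exp (-(lam * (volume.real B * y.toReal)))) := by
  rw [hX.lintegral_pointCount hlam hB hfin fun k => (1 - y) ^ k.toNat]
  set c := lam * volume.real B with hc
  have hc0 : 0 ≤ c := by positivity
  lift y to NNReal using ne_top_of_le_ne_top ENNReal.one_ne_top hy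
  have hy' : (y : ℝ) ≤ 1 := by exact_mod_cast hy
  have h1y : (1 : ℝ≥0∞) - y = ENNReal.ofReal (1 - y) := by
    rw [ENNReal.ofReal_sub _ y.coe_nonneg]; simp
  have hterm : ∀ j : ℕ, ((1 : ℝ≥0∞) - y) ^ ((j : ℕ∞)).toNat *
      ENNReal.ofReal (Real.exp (-c) * c ^ j / (j.factorial : ℝ)) =
      ENNReal.ofReal (Real.exp (-c) * (((1 - y) * c) ^ j / (j.factorial : ℝ))) := by
    intro j
    rw [h1y, ENat.toNat_natCast, ← ENNReal.ofReal_pow (by linarith),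
      ← ENNReal.ofReal_mul (pow_nonneg (by linarith) _)]
    congr 1
    rw [mul_pow _ c]; ring
  simp_rw [hterm]
  have hz : 0 ≤ (1 - (y : ℝ)) * c := mul_nonneg (by linarith) hc0
  rw [← ENNReal.ofReal_tsum_of_nonneg (fun j => by positivity)
    ((Real.summable_pow_div_factorial _).mul_left _), tsum_mul_left,
    tsum_pow_div_factorial, ← Real.exp_add]
  congr 2
  rw [ENNReal.coe_toReal, hc]
  ring

-- The Laplace functional for step functions: the product over points regroups into one power of `1
-- - y i` for each cell, with the count as exponent, and counts of disjoint cells are independent of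
-- each other and of the count in `A`.
open Classical in
lemma lintegral_laplace_step (hX : IsHomogeneousPPP P lam X) [IsProbabilityMeasure P]
    (hlam : 0 < lam) {A : Set Plane} (hA : MeasurableSet A) (hAfin : volume A < ∞)
    (g : ℕ∞ → ℝ≥0∞) {ι : Type*} [Fintype ι] {B : ι → Set Plane} (hB : ∀ i, MeasurableSet (B i))
    (hfin : ∀ i, volume (B i) < ∞) (hdis : Pairwise fun i j => Disjoint (B i) (B j))
    (hAB : ∀ i, Disjoint A (B i)) {y : ι → ℝ≥0∞} (hy : ∀ i, y i ≤ 1) :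
    ∫⁻ ω, g (pointCount (fun n => X n ω) A) *
        infProd (fun n => ∏ i, if X n ω ∈ B i then 1 - y i else 1) ∂P =
      (∫⁻ ω, g (pointCount (fun n => X n ω) A) ∂P) *
        ENNReal.ofReal (Real.exp (-(lam * ∑ i, volume.real (B i) * (y i).toReal))) := by
  -- The index `none` carries `A`, so that a single independence statement covers `A` and all cells.
  set C : Option ι → Set Plane := fun o => o.elim A B with hC
  set G : Option ι → ℕ∞ → ℝ≥0∞ := fun o => o.elim g fun i k => (1 - y i) ^ k.toNat with hG
  have hCm : ∀ o, MeasurableSet (C o) := by rintro (_ | i) <;> simp [hC, hA, hB]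
  have hCfin : ∀ o, volume (C o) < ∞ := by rintro (_ | i) <;> simp [hC, hAfin, hfin]
  have hCdis : Pairwise fun o o' => Disjoint (C o) (C o') := by
    rintro (_ | i) (_ | j) hij
    · exact absurd rfl hij
    · exact hAB j
    · exact (hAB i).symm
    · exact hdis fun h => hij (by rw [h])
  let e := Fintype.equivFin (Option ι)
  have hind : iIndepFun (fun o ω => pointCount (fun n => X n ω) (C o)) P := by
    have := (hX.count_indep _ (fun k => C (e.symm k)) (fun k => hCm _) (fun k => hCfin _)
      fun k k' hk => hCdis fun h => hk (e.symm.injective h)).precomp e.injective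
    simpa using this
  have hind' := hind.comp G fun o => Measurable.of_discrete
  have hcm := fun o => hX.measurable_pointCount (hCm o)
  have hprod := lintegral_prod_eq_prod_lintegral_of_indepFun Finset.univ _ hind'
    fun o => (Measurable.of_discrete (f := G o)).comp (hcm o)
  rw [Fintype.prod_option] at hprod
  simp only [Fintype.prod_option, Function.comp_def] at hprod
  have hae : ∀ᵐ ω ∂P, ∀ i, pointCount (fun n => X n ω) (B i) ≠ ⊤ :=
    ae_all_iff.2 fun i => hX.ae_pointCount_ne_top hlam (hB i) (hfin i)
  have hR : ENNReal.ofReal (Real.exp (-(lam * ∑ i, volume.real (B i) * (y i).toReal))) =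
      ∏ i, ∫⁻ ω, G (some i) (pointCount (fun n => X n ω) (C (some i))) ∂P := by
    rw [Finset.mul_sum, ← Finset.sum_neg_distrib, Real.exp_sum,
      ENNReal.ofReal_prod_of_nonneg fun n _ => (Real.exp_pos _).le]
    exact Finset.prod_congr rfl fun i _ =>
      (hX.lintegral_pow_count hlam (hB i) (hfin i) (hy i)).symm
  rw [hR]
  refine Eq.trans (lintegral_congr_ae ?_) hprod
  filter_upwards [hae] with ω hω
  congr 1
  rw [infProd_finsetProd _ fun i n => by split_ifs <;> simp]
  refine Finset.prod_congr rfl fun i _ => ?_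
  exact infProd_ite_of_finite (Set.encard_ne_top_iff.1 (hω i)) tsub_le_self

/-- The Laplace functional of a Poisson process outside `A`, jointly with the count of `A`. -/
lemma lintegral_laplace (hX : IsHomogeneousPPP P lam X) [IsProbabilityMeasure P]
    (hlam : 0 < lam) {A : Set Plane} (hA : MeasurableSet A) (hAfin : volume A < ∞)
    {g : ℕ∞ → ℝ≥0∞} (hg : ∫⁻ ω, g (pointCount (fun n => X n ω) A) ∂P ≠ ∞)
    {v : Plane → ℝ} (hv : Measurable v) (hv0 : ∀ x, 0 ≤ v x) (hv1 : ∀ x, v x ≤ 1)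
    (hvA : ∀ x ∈ A, v x = 1) (hint : Integrable fun x => 1 - v x) :
    ∫⁻ ω, g (pointCount (fun n => X n ω) A) * infProd (fun n => ENNReal.ofReal (v (X n ω))) ∂P =
      (∫⁻ ω, g (pointCount (fun n => X n ω) A) ∂P) *
        ENNReal.ofReal (Real.exp (-(lam * ∫ x, (1 - v x)))) := by
  classical
  -- Approximating `1 - v` from below by simple functions makes the products decrease to the desired
  -- one; they are dominated by `g` of the count, whose integral is finite.
  set w : Plane → ℝ≥0∞ := fun x => ENNReal.ofReal (1 - v x) with hw
  have hwm : Measurable w := by fun_prop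
  have hwfin : ∫⁻ x, w x ≠ ∞ := hint.lintegral_lt_top.ne
  have hwint : (∫⁻ x, w x).toReal = ∫ x, (1 - v x) := by
    rw [integral_eq_lintegral_of_nonneg_ae (ae_of_all _ fun x => by simpa using hv1 x)
      hint.aestronglyMeasurable]
  set s := SimpleFunc.eapprox w with hs
  have hsup : ∀ x, ⨆ k, s k x = w x := fun x => SimpleFunc.iSup_eapprox_apply hwm x
  have hle : ∀ k x, s k x ≤ w x := fun k x => (le_iSup (fun k => s k x) k).trans (hsup x).le
  have hw1 : ∀ x, w x ≤ 1 := fun x => by simpa [hw] using hv0 x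
  have hmono : ∀ x, Monotone fun k => s k x := fun x k k' h => SimpleFunc.monotone_eapprox w h x
  have hcm := hX.measurable_pointCount hA
  have hgm : Measurable fun ω => g (pointCount (fun n => X n ω) A) :=
    (Measurable.of_discrete (f := g)).comp hcm
  have hstep : ∀ k, ∫⁻ ω, g (pointCount (fun n => X n ω) A) *
      infProd (fun n => 1 - s k (X n ω)) ∂P =
      (∫⁻ ω, g (pointCount (fun n => X n ω) A) ∂P) *
        ENNReal.ofReal (Real.exp (-(lam * (∫⁻ x, s k x).toReal))) := by
    intro k
    -- The value `0` is dropped: it contributes a factor `1` and its level set may have infinite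
    -- area. The other level sets have finite area by Markov's inequality.
    let R := (s k).range.filter (· ≠ 0)
    have hBfin : ∀ y : R, volume (s k ⁻¹' {y.1}) < ∞ := by
      intro y
      have hy0 : y.1 ≠ 0 := (Finset.mem_filter.1 y.2).2
      have hyt : y.1 ≠ ∞ := by
        obtain ⟨x, hx⟩ := SimpleFunc.mem_range.1 (Finset.mem_filter.1 y.2).1
        rw [← hx]
        exact ne_top_of_le_ne_top ENNReal.one_ne_top ((hle k x).trans (hw1 x))
      have := mul_meas_ge_le_lintegral (μ := volume) hwm y.1
      refine (measure_mono (t := {x | y.1 ≤ w x}) fun x hx => ?_).trans_lt ?_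
      · have hx : s k x = y.1 := hx
        rw [mem_ofPred_eq, ← hx]; exact hle k x
      · by_contra h
        rw [not_lt, top_le_iff] at h
        rw [h, ENNReal.mul_top hy0, top_le_iff] at this
        exact hwfin this
    have hy1 : ∀ y : R, y.1 ≤ 1 := by
      intro y
      obtain ⟨x, hx⟩ := SimpleFunc.mem_range.1 (Finset.mem_filter.1 y.2).1
      rw [← hx]
      exact (hle k x).trans (hw1 x)
    have key := hX.lintegral_laplace_step hlam hA hAfin g (ι := R)
      (B := fun y => s k ⁻¹' {y.1}) (fun y => (s k).measurableSet_preimage _) hBfin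
      (fun y y' h => Disjoint.preimage _ (by simpa using fun h' => h (Subtype.ext h')))
      (fun y => by
        rw [Set.disjoint_left]
        intro x hx hxy
        have hxy : s k x = y.1 := hxy
        have h0 : w x = 0 := by simp [hw, hvA x hx]
        have := hle k x
        rw [h0, hxy, nonpos_iff_eq_zero] at this
        exact (Finset.mem_filter.1 y.2).2 this) (y := fun y => y.1) hy1
    have hprod : ∀ x, ∏ y : R, (if x ∈ s k ⁻¹' {y.1} then 1 - y.1 else 1) = 1 - s k x := by
      intro x
      rw [Finset.prod_coe_sort R fun y => if x ∈ s k ⁻¹' {y} then 1 - y else 1]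
      simp only [mem_preimage, mem_singleton_iff]
      rw [Finset.prod_ite_eq]
      split_ifs with h
      · rfl
      · have : s k x = 0 := by
          by_contra h0
          exact h (Finset.mem_filter.2 ⟨SimpleFunc.mem_range_self _ _, h0⟩)
        simp [this]
    have hsum : ∑ y : R, volume.real (s k ⁻¹' {y.1}) * y.1.toReal = (∫⁻ x, s k x).toReal := by
      rw [SimpleFunc.lintegral_eq_lintegral, SimpleFunc.lintegral,
        Finset.sum_coe_sort R fun y => volume.real (s k ⁻¹' {y}) * y.toReal]
      have h0 : ∑ y ∈ (s k).range, y * volume (s k ⁻¹' {y}) =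
          ∑ y ∈ R, y * volume (s k ⁻¹' {y}) := by
        rw [Finset.sum_filter]
        exact Finset.sum_congr rfl fun y _ => by split_ifs with h <;> simp_all
      rw [h0, ENNReal.toReal_sum]
      · exact Finset.sum_congr rfl fun y _ => by
          rw [ENNReal.toReal_mul, mul_comm]; rfl
      · intro y hy
        exact ENNReal.mul_ne_top (ne_top_of_le_ne_top ENNReal.one_ne_top (hy1 ⟨y, hy⟩))
          (hBfin ⟨y, hy⟩).ne
    simp_rw [hprod, hsum] at key
    exact key
  have hlimR : Tendsto (fun k => (∫⁻ ω, g (pointCount (fun n => X n ω) A) ∂P) *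
      ENNReal.ofReal (Real.exp (-(lam * (∫⁻ x, s k x).toReal)))) atTop
      (𝓝 ((∫⁻ ω, g (pointCount (fun n => X n ω) A) ∂P) *
        ENNReal.ofReal (Real.exp (-(lam * ∫ x, (1 - v x)))))) := by
    refine ENNReal.Tendsto.const_mul (ENNReal.tendsto_ofReal ?_) (Or.inr hg)
    refine Real.continuous_exp.continuousAt.tendsto.comp (Tendsto.neg (Tendsto.const_mul _ ?_))
    rw [← hwint]
    refine (ENNReal.tendsto_toReal hwfin).comp ?_
    refine lintegral_tendsto_of_tendsto_of_monotone (fun k => (s k).measurable.aemeasurable)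
      (ae_of_all _ hmono) (ae_of_all _ fun x => ?_)
    rw [← hsup x]
    exact tendsto_atTop_iSup (hmono x)
  refine tendsto_nhds_unique ?_ hlimR
  simp_rw [← hstep]
  refine tendsto_lintegral_of_dominated_convergence
    (fun ω => g (pointCount (fun n => X n ω) A)) (fun k => ?_) (fun k => ?_) hg ?_
  · refine hgm.mul (measurable_infProd fun n => ?_)
    exact measurable_const.sub ((s k).measurable.comp (hX.measurable n))
  · exact ae_of_all _ fun ω => mul_le_of_le_one_right' (infProd_le_one _)
  · filter_upwards [ae_lt_top hgm hg] with ω hω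
    refine ENNReal.Tendsto.const_mul ?_ (Or.inr hω.ne)
    have hv' : ∀ x, ENNReal.ofReal (v x) = ⨅ k, (1 - s k x) := by
      intro x
      rw [← ENNReal.sub_iSup ENNReal.one_ne_top, hsup, hw]
      simp only
      rw [← ENNReal.ofReal_one, ← ENNReal.ofReal_sub _ (by simpa using hv1 x)]
      simp
    simp_rw [hv']
    have hanti : Antitone fun k n => 1 - s k (X n ω) :=
      fun k k' h n => tsub_le_tsub_left (hmono (X n ω) h) 1
    rw [← iInf_infProd (y := fun k n => 1 - s k (X n ω)) (fun k n => tsub_le_self) hanti]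
    exact tendsto_atTop_iInf fun k k' h => infProd_mono fun n => hanti h n

end IsHomogeneousPPP

/-! ### Geometric annuli in the plane -/

/-- The annulus between the circles of radii `ρ ^ i` and `ρ ^ (i + 1)` around the origin. -/
def annulus (ρ : ℝ) (i : ℤ) : Set Plane := {x | ρ ^ i ≤ ‖x‖ ∧ ‖x‖ < ρ ^ (i + 1)}

section Annulus

variable {ρ : ℝ}

lemma measurableSet_annulus (ρ : ℝ) (i : ℤ) : MeasurableSet (annulus ρ i) :=
  (measurableSet_le measurable_const measurable_norm).inter
    (measurableSet_lt measurable_norm measurable_const)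

lemma volume_annulus_lt_top (ρ : ℝ) (i : ℤ) : volume (annulus ρ i) < ∞ :=
  (measure_mono fun x hx => by simpa using hx.2).trans_lt
    (measure_ball_lt_top (x := (0 : Plane)) (r := ρ ^ (i + 1)))

lemma volume_real_annulus (hρ : 1 < ρ) (i : ℤ) :
    volume.real (annulus ρ i) = Real.pi * (ρ ^ 2 - 1) * (ρ ^ i) ^ 2 := by
  have h0 : 0 < ρ ^ i := zpow_pos (by linarith) i
  have h1 : ρ ^ (i + 1) = ρ ^ i * ρ := zpow_add_one₀ (by linarith) i
  have hset : annulus ρ i = Metric.ball 0 (ρ ^ (i + 1)) \ Metric.ball 0 (ρ ^ i) := by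
    ext x
    simp [annulus, and_comm]
  have hball : ∀ r : ℝ, 0 ≤ r → volume.real (Metric.ball (0 : Plane) r) = Real.pi * r ^ 2 := by
    intro r hr
    rw [measureReal_def, EuclideanSpace.volume_ball_fin_two]
    simp [ENNReal.toReal_ofReal hr, mul_comm, Real.pi_pos.le]
  rw [hset, measureReal_sdiff (Metric.ball_subset_ball (by rw [h1]; nlinarith))
    measurableSet_ball, hball _ (by rw [h1]; positivity), hball _ h0.le, h1]
  ring

lemma exists_mem_annulus (hρ : 1 < ρ) {x : Plane} (hx : x ≠ 0) : ∃ i, x ∈ annulus ρ i :=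
  exists_mem_Ico_zpow (norm_pos_iff.2 hx) hρ

lemma pairwise_disjoint_annulus (hρ : 1 < ρ) :
    Pairwise fun i j => Disjoint (annulus ρ i) (annulus ρ j) := by
  intro i j hij
  rw [Set.disjoint_left]
  rintro x ⟨h1, h2⟩ ⟨h3, h4⟩
  have h5 := (zpow_lt_zpow_iff_right₀ hρ).1 (h1.trans_lt h4)
  have h6 := (zpow_lt_zpow_iff_right₀ hρ).1 (h3.trans_lt h2)
  omega

lemma tsum_indicator_annulus_le (hρ : 1 < ρ) (x : Plane) :
    ∑' i, (annulus ρ i).indicator (fun _ => (1 : ℝ≥0∞)) x ≤ 1 := by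
  by_cases h : ∃ i, x ∈ annulus ρ i
  · obtain ⟨i, hi⟩ := h
    rw [tsum_eq_single i, indicator_of_mem hi]
    intro j hj
    rw [indicator_of_notMem]
    exact fun h => Set.disjoint_left.1 (pairwise_disjoint_annulus hρ hj) h hi
  · push Not at h
    simp [indicator_of_notMem (h _)]

lemma iUnion_annulus (hρ : 1 < ρ) : ⋃ i, annulus ρ i = {0}ᶜ := by
  ext x
  rw [mem_iUnion, mem_compl_iff, mem_singleton_iff]
  refine ⟨?_, fun h => exists_mem_annulus hρ h⟩
  rintro ⟨i, hi, -⟩ rfl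
  rw [norm_zero] at hi
  exact absurd (zpow_pos (by linarith : (0 : ℝ) < ρ) i) (not_lt.2 hi)

end Annulus

lemma lintegral_exp_neg_mul_sq_norm {c : ℝ} (hc : 0 < c) :
    ∫⁻ x : Plane, ENNReal.ofReal (Real.exp (-(c * ‖x‖ ^ 2))) = ENNReal.ofReal (Real.pi / c) := by
  have h := GaussianFourier.integral_rexp_neg_mul_sq_norm (V := Plane) hc
  have hfin : (Module.finrank ℝ Plane : ℝ) / 2 = 1 := by simp [Plane]
  rw [hfin, Real.rpow_one] at h
  simp only [neg_mul] at h
  rw [← h, ofReal_integral_eq_lintegral_ofReal _ (ae_of_all _ fun x => (Real.exp_pos _).le)]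
  refine Integrable.of_integral_ne_zero ?_
  rw [h]
  have := Real.pi_pos
  positivity

/-- The sum over annuli of a Gaussian integral on each. -/
lemma tsum_lintegral_annulus {ρ : ℝ} (hρ : 1 < ρ) {lam c : ℝ} (hlam : 0 < lam) (hc : 0 < c) :
    ∑' i, ∫⁻ x in annulus ρ i, ENNReal.ofReal (lam * Real.exp (-(lam * c * ‖x‖ ^ 2))) =
      ENNReal.ofReal (Real.pi / c) := by
  rw [← lintegral_iUnion (measurableSet_annulus ρ) (pairwise_disjoint_annulus hρ),
    iUnion_annulus hρ]
  have hae : ({0}ᶜ : Set Plane) =ᵐ[volume] univ := by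
    rw [ae_eq_univ, compl_compl]
    exact measure_singleton 0
  rw [setLIntegral_congr hae, setLIntegral_univ]
  simp_rw [ENNReal.ofReal_mul hlam.le]
  rw [lintegral_const_mul _ (by fun_prop), lintegral_exp_neg_mul_sq_norm (by positivity),
    ← ENNReal.ofReal_mul hlam.le]
  congr 1
  field_simp

/-! ### Radial profiles and the scale-invariant Campbell–Mecke formula -/

section Profile

variable {v : ℝ → ℝ}

lemma integrable_profile_scaled (hint : Integrable fun x : Plane => 1 - v ‖x‖) {r : ℝ}
    (hr : 0 < r) : Integrable fun x : Plane => 1 - v (‖x‖ / r) := by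
  have := hint.comp_smul (R := r⁻¹) (inv_ne_zero hr.ne')
  simpa [norm_smul, abs_of_pos hr, div_eq_inv_mul] using this

/-- Substitution `x ↦ x / r` in dimension two. The factor `r ^ 2` later becomes the exponent of a
Gaussian. -/
lemma integral_profile_scaled {r : ℝ} (hr : 0 < r) :
    ∫ x : Plane, (1 - v (‖x‖ / r)) = r ^ 2 * ∫ x : Plane, (1 - v ‖x‖) := by
  have := Measure.integral_comp_smul (volume : Measure Plane) (fun x : Plane => 1 - v ‖x‖) r⁻¹
  have hfin : Module.finrank ℝ Plane = 2 := by simp [Plane]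
  rw [hfin] at this
  simpa [norm_smul, abs_of_pos hr, div_eq_inv_mul] using this

open Classical in
/-- A radial profile of scale `r`, set to `1` on an annulus. -/
def outerProfile (v : ℝ → ℝ) (ρ : ℝ) (i : ℤ) (r : ℝ) (x : Plane) : ℝ :=
  if x ∈ annulus ρ i then 1 else v (‖x‖ / r)

lemma measurable_outerProfile (hmono : Monotone v) (ρ : ℝ) (i : ℤ) (r : ℝ) :
    Measurable (outerProfile v ρ i r) :=
  Measurable.ite (measurableSet_annulus ρ i) measurable_const
    (hmono.measurable.comp (measurable_norm.div_const r))

lemma one_sub_outerProfile (ρ : ℝ) (i : ℤ) (r : ℝ) (x : Plane) :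
    1 - outerProfile v ρ i r x = (annulus ρ i)ᶜ.indicator (fun x => 1 - v (‖x‖ / r)) x := by
  by_cases h : x ∈ annulus ρ i <;> simp [outerProfile, h]

lemma integrable_outerProfile (hint : Integrable fun x : Plane => 1 - v ‖x‖) (ρ : ℝ) (i : ℤ)
    {r : ℝ} (hr : 0 < r) : Integrable fun x => 1 - outerProfile v ρ i r x := by
  simp_rw [one_sub_outerProfile]
  exact (integrable_profile_scaled hint hr).indicator (measurableSet_annulus ρ i).compl

lemma integral_outerProfile_le (hv1 : ∀ u, v u ≤ 1)
    (hint : Integrable fun x : Plane => 1 - v ‖x‖) (ρ : ℝ) (i : ℤ) {r : ℝ} (hr : 0 < r) :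
    ∫ x, (1 - outerProfile v ρ i r x) ≤ r ^ 2 * ∫ x : Plane, (1 - v ‖x‖) := by
  rw [← integral_profile_scaled hr]
  refine integral_mono (integrable_outerProfile hint ρ i hr) (integrable_profile_scaled hint hr)
    fun x => ?_
  simp only [one_sub_outerProfile]
  exact indicator_le_self' (fun _ _ => sub_nonneg.2 (hv1 _)) x

/-- Resetting the profile to `1` on the annulus removes at most its area, because `1 - v ≤ 1`. -/
lemma le_integral_outerProfile (hv0 : ∀ u, 0 ≤ v u)
    (hint : Integrable fun x : Plane => 1 - v ‖x‖) (ρ : ℝ) (i : ℤ) {r : ℝ} (hr : 0 < r) :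
    r ^ 2 * (∫ x : Plane, (1 - v ‖x‖)) - volume.real (annulus ρ i) ≤
      ∫ x, (1 - outerProfile v ρ i r x) := by
  have hI := integrable_outerProfile hint ρ i hr
  have h1 : Integrable ((annulus ρ i).indicator (1 : Plane → ℝ)) :=
    (integrable_indicator_iff (measurableSet_annulus ρ i)).2
      (integrableOn_const (volume_annulus_lt_top ρ i).ne)
  rw [sub_le_iff_le_add, ← integral_profile_scaled hr, ← integral_indicator_one
    (measurableSet_annulus ρ i), ← integral_add hI h1]
  refine integral_mono (integrable_profile_scaled hint hr) (hI.add h1) fun x => ?_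
  by_cases h : x ∈ annulus ρ i
  · simp [outerProfile, h, hv0]
  · simp [outerProfile, h]

end Profile

/-- The product over all points but the `b`-th of a profile of their distances relative to that
of the `b`-th point. -/
def relativeProd (v : ℝ → ℝ) (x : ℕ → Plane) (b : ℕ) : ℝ≥0∞ :=
  infProd fun n => if n = b then 1 else ENNReal.ofReal (v (‖x n‖ / ‖x b‖))

/-- Replacing `‖x b‖` by the inner radius enlarges all distance ratios, and `v` is monotone. Raising
the factors inside the annulus to `1` leaves a product that depends only on points outside it, hence
decouples from its count. -/
lemma relativeProd_le {v : ℝ → ℝ} (hmono : Monotone v) {ρ : ℝ} (hρ : 1 < ρ)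
    {x : ℕ → Plane} {b : ℕ} {i : ℤ} (hv1 : ∀ u, v u ≤ 1) (hb : x b ∈ annulus ρ i) :
    relativeProd v x b ≤ infProd fun n => ENNReal.ofReal (outerProfile v ρ i (ρ ^ i) (x n)) := by
  refine infProd_mono fun n => ?_
  have h0 : 0 < ρ ^ i := zpow_pos (by linarith) i
  split_ifs with hn
  · simp [outerProfile, hn, hb]
  · refine ENNReal.ofReal_le_ofReal ?_
    rw [outerProfile]
    split_ifs
    · exact hv1 _
    · exact hmono (div_le_div_of_nonneg_left (norm_nonneg _) h0 hb.1)

/-- Here the outer radius replaces `‖x b‖`. Uniqueness of the point is essential: a second point in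
the annulus would have its factor raised to `1`, in the wrong direction for a lower bound. -/
lemma le_relativeProd {v : ℝ → ℝ} (hmono : Monotone v) {ρ : ℝ} (hρ : 1 < ρ)
    {x : ℕ → Plane} {b : ℕ} {i : ℤ} (hb : x b ∈ annulus ρ i)
    (huniq : ∀ n, x n ∈ annulus ρ i → n = b) :
    infProd (fun n => ENNReal.ofReal (outerProfile v ρ i (ρ ^ (i + 1)) (x n))) ≤
      relativeProd v x b := by
  refine infProd_mono fun n => ?_
  have h0 : 0 < ρ ^ i := zpow_pos (by linarith) i
  split_ifs with hn
  · rw [hn]; simp [outerProfile, hb]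
  · refine ENNReal.ofReal_le_ofReal ?_
    rw [outerProfile, if_neg fun h => hn (huniq n h)]
    exact hmono (div_le_div_of_nonneg_left (norm_nonneg _) (h0.trans_le hb.1) hb.2.le)

lemma tsum_relativeProd_le {v : ℝ → ℝ} (hmono : Monotone v) (hv1 : ∀ u, v u ≤ 1) {ρ : ℝ}
    (hρ : 1 < ρ) {x : ℕ → Plane} (hx : ∀ n, x n ≠ 0) :
    ∑' b, relativeProd v x b ≤ ∑' i, ((pointCount x (annulus ρ i) : ℕ∞) : ℝ≥0∞) *
      infProd fun n => ENNReal.ofReal (outerProfile v ρ i (ρ ^ i) (x n)) := by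
  simp_rw [toENNReal_pointCount, ← ENNReal.tsum_mul_right]
  rw [ENNReal.tsum_comm]
  refine ENNReal.tsum_le_tsum fun b => ?_
  obtain ⟨i, hi⟩ := exists_mem_annulus hρ (hx b)
  refine le_trans ?_ (ENNReal.le_tsum i)
  rw [indicator_of_mem hi, one_mul]
  exact relativeProd_le hmono hρ hv1 hi

/-- Only annuli containing exactly one point are kept. For thin annuli the loss is negligible, since
two points in one annulus is an event of second order. -/
lemma le_tsum_relativeProd {v : ℝ → ℝ} (hmono : Monotone v) {ρ : ℝ}
    (hρ : 1 < ρ) (x : ℕ → Plane) :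
    ∑' i, (if pointCount x (annulus ρ i) = 1 then 1 else 0) *
      infProd (fun n => ENNReal.ofReal (outerProfile v ρ i (ρ ^ (i + 1)) (x n))) ≤
      ∑' b, relativeProd v x b := by
  have h1 : ∑' i, ∑' b, (annulus ρ i).indicator (fun _ => (1 : ℝ≥0∞)) (x b) * relativeProd v x b ≤
      ∑' b, relativeProd v x b := by
    rw [ENNReal.tsum_comm]
    refine ENNReal.tsum_le_tsum fun b => ?_
    rw [ENNReal.tsum_mul_right]
    exact mul_le_of_le_one_left' (tsum_indicator_annulus_le hρ (x b))
  refine le_trans (ENNReal.tsum_le_tsum fun i => ?_) h1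
  split_ifs with h
  · obtain ⟨b, hb⟩ := Set.encard_eq_one.1 h
    have hbm : x b ∈ annulus ρ i := by
      have : b ∈ {n | x n ∈ annulus ρ i} := by rw [hb]; rfl
      exact this
    refine le_trans ?_ (ENNReal.le_tsum b)
    rw [indicator_of_mem hbm, one_mul, one_mul]
    refine le_relativeProd hmono hρ hbm fun n hn => ?_
    have : n ∈ {n | x n ∈ annulus ρ i} := hn
    rw [hb] at this
    exact this
  · simp

namespace IsHomogeneousPPP

variable {Ω : Type*} [MeasurableSpace Ω] {P : Measure Ω} {lam : ℝ} {X : ℕ → Ω → Plane}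

/-- The singleton of the origin has area zero, so its count is Poisson of mean zero. The origin is
the only point missed by the annuli. -/
lemma ae_ne_zero [IsProbabilityMeasure P] (hX : IsHomogeneousPPP P lam X) :
    ∀ᵐ ω ∂P, ∀ n, X n ω ≠ 0 := by
  have h := hX.count_law {0} (measurableSet_singleton 0) (by simp) 0
  have hm := hX.measurable_pointCount (measurableSet_singleton (0 : Plane))
  simp only [measureReal_def, measure_singleton, ENNReal.toReal_zero, mul_zero, neg_zero,
    Real.exp_zero, pow_zero, Nat.factorial_zero, Nat.cast_one, div_one, mul_one,
    ENNReal.ofReal_one] at h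
  have h0 := (prob_compl_eq_zero_iff (hm (measurableSet_singleton ((0 : ℕ) : ℕ∞)))).2 h
  have hae : ∀ᵐ ω ∂P, pointCount (fun n => X n ω) {0} = ((0 : ℕ) : ℕ∞) := h0
  filter_upwards [hae] with ω hω n hn
  rw [Nat.cast_zero, pointCount, Set.encard_eq_zero] at hω
  have : n ∈ {n | X n ω ∈ ({0} : Set Plane)} := hn
  rw [hω] at this
  exact this

variable {v : ℝ → ℝ}

/-- On each annulus the expectation is the mean count times a Laplace functional, that is `lam`
times the area times an exponential. This is bounded by the integral of a Gaussian density over the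
annulus, and the Gaussian integrals add up over the plane. -/
lemma lintegral_tsum_relativeProd_le [IsProbabilityMeasure P] (hX : IsHomogeneousPPP P lam X)
    (hlam : 0 < lam) (hmono : Monotone v) (hv0 : ∀ u, 0 ≤ v u) (hv1 : ∀ u, v u ≤ 1)
    (hint : Integrable fun x : Plane => 1 - v ‖x‖) {ρ : ℝ} (hρ : 1 < ρ)
    (hpos : 0 < (∫ x : Plane, (1 - v ‖x‖)) - Real.pi * (ρ ^ 2 - 1)) :
    ∫⁻ ω, ∑' b, relativeProd v (fun n => X n ω) b ∂P ≤
      ENNReal.ofReal (Real.pi / (((∫ x : Plane, (1 - v ‖x‖)) - Real.pi * (ρ ^ 2 - 1)) / ρ ^ 2)) := by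
  set I := ∫ x : Plane, (1 - v ‖x‖) with hI
  have hρ0 : 0 < ρ := by linarith
  have hae : ∀ᵐ ω ∂P, ∑' b, relativeProd v (fun n => X n ω) b ≤
      ∑' i, ((pointCount (fun n => X n ω) (annulus ρ i) : ℕ∞) : ℝ≥0∞) *
        infProd fun n => ENNReal.ofReal (outerProfile v ρ i (ρ ^ i) (X n ω)) := by
    filter_upwards [hX.ae_ne_zero] with ω hω
    exact tsum_relativeProd_le hmono hv1 hρ hω
  refine (lintegral_mono_ae hae).trans ?_
  rw [lintegral_tsum]
  swap
  · intro i
    refine (((Measurable.of_discrete (f := fun k : ℕ∞ => (k : ℝ≥0∞))).comp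
      (hX.measurable_pointCount (measurableSet_annulus ρ i))).mul
      (measurable_infProd fun n => ?_)).aemeasurable
    exact ((measurable_outerProfile hmono ρ i _).comp (hX.measurable n)).ennreal_ofReal
  rw [← tsum_lintegral_annulus hρ hlam (div_pos hpos (by positivity))]
  refine ENNReal.tsum_le_tsum fun i => ?_
  have h0 : 0 < ρ ^ i := zpow_pos hρ0 i
  have hfin := volume_annulus_lt_top ρ i
  have hcount := hX.lintegral_count hlam (measurableSet_annulus ρ i) hfin
  rw [hX.lintegral_laplace hlam (measurableSet_annulus ρ i) hfin (g := fun k => (k : ℝ≥0∞))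
    (by rw [hcount]; exact ENNReal.ofReal_ne_top) (measurable_outerProfile hmono ρ i _)
    (fun x => by rw [outerProfile]; split_ifs <;> simp [hv0])
    (fun x => by rw [outerProfile]; split_ifs <;> simp [hv1])
    (fun x hx => by simp [outerProfile, hx]) (integrable_outerProfile hint ρ i h0), hcount]
  -- The annulus has area `π (ρ² - 1) (ρ ^ i)²`, so the exponent is at least `lam (I - π (ρ² - 1))
  -- (ρ ^ i)²`; dividing by `ρ²` accounts for `‖x‖` being as large as the outer radius.
  have hlow : ∀ x ∈ annulus ρ i, ENNReal.ofReal lam * ENNReal.ofReal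
      (Real.exp (-(lam * ∫ x, (1 - outerProfile v ρ i (ρ ^ i) x)))) ≤
      ENNReal.ofReal (lam * Real.exp (-(lam * ((I - Real.pi * (ρ ^ 2 - 1)) / ρ ^ 2) * ‖x‖ ^ 2))) := by
    intro x hx
    rw [← ENNReal.ofReal_mul hlam.le]
    refine ENNReal.ofReal_le_ofReal (mul_le_mul_of_nonneg_left (Real.exp_le_exp.2 ?_) hlam.le)
    rw [neg_le_neg_iff, mul_assoc]
    refine mul_le_mul_of_nonneg_left ?_ hlam.le
    refine le_trans ?_ (le_integral_outerProfile hv0 hint ρ i h0)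
    have h1 : ρ ^ (i + 1) = ρ ^ i * ρ := zpow_add_one₀ hρ0.ne' i
    have h2 : ‖x‖ ^ 2 ≤ (ρ ^ i) ^ 2 * ρ ^ 2 := by
      rw [← mul_pow, ← h1]
      exact pow_le_pow_left₀ (norm_nonneg _) hx.2.le 2
    rw [volume_real_annulus hρ]
    calc (I - Real.pi * (ρ ^ 2 - 1)) / ρ ^ 2 * ‖x‖ ^ 2
        ≤ (I - Real.pi * (ρ ^ 2 - 1)) / ρ ^ 2 * ((ρ ^ i) ^ 2 * ρ ^ 2) :=
          mul_le_mul_of_nonneg_left h2 (by positivity)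
      _ = _ := by rw [← hI]; field_simp
  refine le_trans (le_of_eq ?_) (setLIntegral_mono' (measurableSet_annulus ρ i) hlow)
  rw [setLIntegral_const, ENNReal.ofReal_mul hlam.le, measureReal_def,
    ENNReal.ofReal_toReal hfin.ne]
  ring

lemma le_lintegral_tsum_relativeProd [IsProbabilityMeasure P] (hX : IsHomogeneousPPP P lam X)
    (hlam : 0 < lam) (hmono : Monotone v) (hv0 : ∀ u, 0 ≤ v u) (hv1 : ∀ u, v u ≤ 1)
    (hint : Integrable fun x : Plane => 1 - v ‖x‖) {ρ : ℝ} (hρ : 1 < ρ)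
    (hpos : 0 < ∫ x : Plane, (1 - v ‖x‖)) :
    ENNReal.ofReal (Real.pi / (ρ ^ 2 * (∫ x : Plane, (1 - v ‖x‖)) + Real.pi * (ρ ^ 2 - 1))) ≤
      ∫⁻ ω, ∑' b, relativeProd v (fun n => X n ω) b ∂P := by
  set I := ∫ x : Plane, (1 - v ‖x‖) with hI
  have hρ0 : 0 < ρ := by linarith
  have hρ2 : 0 < ρ ^ 2 - 1 := by nlinarith
  have hc : 0 < ρ ^ 2 * I + Real.pi * (ρ ^ 2 - 1) := by
    have := Real.pi_pos
    positivity
  refine le_trans ?_ (lintegral_mono fun ω => le_tsum_relativeProd hmono hρ fun n => X n ω)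
  rw [lintegral_tsum]
  swap
  · intro i
    refine (((Measurable.of_discrete (f := fun k : ℕ∞ => if k = 1 then (1 : ℝ≥0∞) else 0)).comp
      (hX.measurable_pointCount (measurableSet_annulus ρ i))).mul
      (measurable_infProd fun n => ?_)).aemeasurable
    exact ((measurable_outerProfile hmono ρ i _).comp (hX.measurable n)).ennreal_ofReal
  rw [← tsum_lintegral_annulus hρ hlam hc]
  refine ENNReal.tsum_le_tsum fun i => ?_
  have h0 : 0 < ρ ^ i := zpow_pos hρ0 i
  have h0' : 0 < ρ ^ (i + 1) := zpow_pos hρ0 _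
  have hfin := volume_annulus_lt_top ρ i
  have hD0 : 0 ≤ volume.real (annulus ρ i) := measureReal_nonneg
  have hcount : ∫⁻ ω, (if pointCount (fun n => X n ω) (annulus ρ i) = 1 then (1 : ℝ≥0∞) else 0) ∂P =
      ENNReal.ofReal (Real.exp (-(lam * volume.real (annulus ρ i))) *
        (lam * volume.real (annulus ρ i))) := by
    rw [hX.lintegral_pointCount hlam (measurableSet_annulus ρ i) hfin
      fun k => if k = 1 then (1 : ℝ≥0∞) else 0, tsum_eq_single 1]
    · simp
    · intro j hj
      simp [hj]
  rw [hX.lintegral_laplace hlam (measurableSet_annulus ρ i) hfin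
    (g := fun k => if k = 1 then (1 : ℝ≥0∞) else 0)
    (by rw [hcount]; exact ENNReal.ofReal_ne_top) (measurable_outerProfile hmono ρ i _)
    (fun x => by rw [outerProfile]; split_ifs <;> simp [hv0])
    (fun x => by rw [outerProfile]; split_ifs <;> simp [hv1])
    (fun x hx => by simp [outerProfile, hx]) (integrable_outerProfile hint ρ i h0'), hcount]
  set J := ∫ x, (1 - outerProfile v ρ i (ρ ^ (i + 1)) x) with hJ
  -- The area in the exponent comes from the probability of exactly one point. At scale `ρ ^ (i +
  -- 1)` the profile contributes at most `(ρ ^ i)² ρ² I`, and `ρ ^ i ≤ ‖x‖`.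
  have hup : ∀ x ∈ annulus ρ i,
      ENNReal.ofReal (lam * Real.exp (-(lam * (ρ ^ 2 * I + Real.pi * (ρ ^ 2 - 1)) * ‖x‖ ^ 2))) ≤
      ENNReal.ofReal (lam * Real.exp (-(lam * (volume.real (annulus ρ i) + J)))) := by
    intro x hx
    refine ENNReal.ofReal_le_ofReal (mul_le_mul_of_nonneg_left (Real.exp_le_exp.2 ?_) hlam.le)
    rw [neg_le_neg_iff, mul_assoc]
    refine mul_le_mul_of_nonneg_left ?_ hlam.le
    have h1 : ρ ^ (i + 1) = ρ ^ i * ρ := zpow_add_one₀ hρ0.ne' i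
    have h2 : (ρ ^ i) ^ 2 ≤ ‖x‖ ^ 2 := pow_le_pow_left₀ h0.le hx.1 2
    have h3 := integral_outerProfile_le hv1 hint ρ i h0'
    rw [← hJ, ← hI, h1] at h3
    rw [volume_real_annulus hρ]
    nlinarith [mul_le_mul_of_nonneg_left h2 hc.le]
  refine (setLIntegral_mono' (measurableSet_annulus ρ i) hup).trans (le_of_eq ?_)
  rw [setLIntegral_const, ← ENNReal.ofReal_toReal hfin.ne, ← measureReal_def,
    ← ENNReal.ofReal_mul (by positivity), ← ENNReal.ofReal_mul (by positivity)]
  congr 1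
  rw [mul_add, neg_add, Real.exp_add]
  ring

/-- A scale-invariant form of the Campbell–Mecke formula. -/
theorem lintegral_tsum_relativeProd [IsProbabilityMeasure P] (hX : IsHomogeneousPPP P lam X)
    (hlam : 0 < lam) (hmono : Monotone v) (hv0 : ∀ u, 0 ≤ v u) (hv1 : ∀ u, v u ≤ 1)
    (hint : Integrable fun x : Plane => 1 - v ‖x‖) (hpos : 0 < ∫ x : Plane, (1 - v ‖x‖)) :
    ∫⁻ ω, ∑' b, relativeProd v (fun n => X n ω) b ∂P =
      ENNReal.ofReal (Real.pi / ∫ x : Plane, (1 - v ‖x‖)) := by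
  set I := ∫ x : Plane, (1 - v ‖x‖) with hI
  have hlim1 : Tendsto (fun ρ : ℝ => I - Real.pi * (ρ ^ 2 - 1)) (𝓝[>] 1) (𝓝 I) := by
    have : ContinuousAt (fun ρ : ℝ => I - Real.pi * (ρ ^ 2 - 1)) 1 := by fun_prop
    simpa [ContinuousAt] using this.tendsto.mono_left nhdsWithin_le_nhds
  have hlim2 : Tendsto (fun ρ : ℝ => ρ ^ 2) (𝓝[>] 1) (𝓝 1) := by
    have : ContinuousAt (fun ρ : ℝ => ρ ^ 2) 1 := by fun_prop
    simpa [ContinuousAt] using this.tendsto.mono_left nhdsWithin_le_nhds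
  have hlim3 : Tendsto (fun ρ : ℝ => ρ ^ 2 * I + Real.pi * (ρ ^ 2 - 1)) (𝓝[>] 1) (𝓝 I) := by
    have : ContinuousAt (fun ρ : ℝ => ρ ^ 2 * I + Real.pi * (ρ ^ 2 - 1)) 1 := by fun_prop
    simpa [ContinuousAt] using this.tendsto.mono_left nhdsWithin_le_nhds
  refine le_antisymm ?_ ?_
  · have hT := ENNReal.tendsto_ofReal ((tendsto_const_nhds (x := Real.pi)).div
      (hlim1.div hlim2 one_ne_zero) (by simpa using hpos.ne'))
    rw [div_one] at hT
    refine ge_of_tendsto hT ?_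
    filter_upwards [hlim1.eventually (lt_mem_nhds hpos), self_mem_nhdsWithin] with ρ h1 h2
    exact hX.lintegral_tsum_relativeProd_le hlam hmono hv0 hv1 hint h2 h1
  · have hT := ENNReal.tendsto_ofReal ((tendsto_const_nhds (x := Real.pi)).div hlim3 hpos.ne')
    refine le_of_tendsto hT ?_
    filter_upwards [self_mem_nhdsWithin] with ρ h2
    exact hX.le_lintegral_tsum_relativeProd hlam hmono hv0 hv1 hint h2 hpos

end IsHomogeneousPPP

/-! ### The tail integral, the incomplete Beta function and the averaged profile -/

/-- The integrated interference of the points beyond unit distance, at threshold `T`. -/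
def tailIntegral (T α : ℝ) : ℝ := ∫ u in Ioi (1 : ℝ), u * (T / (T + u ^ α))

lemma tailIntegral_zero (α : ℝ) : tailIntegral 0 α = 0 := by simp [tailIntegral]

lemma tailIntegral_nonneg {T : ℝ} (hT : 0 ≤ T) (α : ℝ) : 0 ≤ tailIntegral T α := by
  refine setIntegral_nonneg measurableSet_Ioi fun u hu => ?_
  have : 0 < u := zero_lt_one.trans hu
  positivity

lemma integrableOn_tail {T α : ℝ} (hT : 0 ≤ T) (hα : 2 < α) :
    IntegrableOn (fun u : ℝ => u * (T / (T + u ^ α))) (Ioi 1) := by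
  have h1 : IntegrableOn (fun u : ℝ => T * u ^ (1 - α)) (Ioi 1) :=
    (integrableOn_Ioi_rpow_of_lt (by linarith) zero_lt_one).const_mul T
  refine h1.mono' (by fun_prop) ((ae_restrict_iff' measurableSet_Ioi).2 (ae_of_all _ fun u hu => ?_))
  have hu : 0 < u := zero_lt_one.trans hu
  have hp : 0 < u ^ α := Real.rpow_pos_of_pos hu α
  rw [Real.norm_of_nonneg (by positivity), Real.rpow_sub hu, Real.rpow_one, ← mul_div_assoc,
    ← mul_div_assoc, mul_comm u T]
  exact div_le_div_of_nonneg_left (by positivity) hp (by linarith)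

/-- The substitution `w = u ^ α / (T + u ^ α)`. -/
lemma tailIntegral_eq_compIncBeta {T α : ℝ} (hT : 0 < T) (hα : 0 < α) :
    2 * tailIntegral T α =
      2 / α * T ^ (2 / α) * compIncBeta (2 / α) (1 - 2 / α) (1 + T)⁻¹ := by
  have hz0 : 0 < (1 + T)⁻¹ := by positivity
  have hz1 : (1 + T)⁻¹ < 1 := inv_lt_one_of_one_lt₀ (by linarith)
  set z := (1 + T)⁻¹ with hz
  -- `φ` is the inverse of the substitution; `u = 1` corresponds to the lower endpoint `z` and `u →
  -- ∞` to `w → 1`.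
  set φ : ℝ → ℝ := fun w => (T * (w / (1 - w))) ^ (1 / α) with hφ
  set φ' : ℝ → ℝ := fun w =>
    T * ((1 * (1 - w) - w * (-1)) / (1 - w) ^ 2) * (1 / α) * (T * (w / (1 - w))) ^ (1 / α - 1)
    with hφ'
  have hpos : ∀ w ∈ Ioo z 1, 0 < w ∧ 0 < 1 - w ∧ 0 < T * (w / (1 - w)) := by
    intro w hw
    have h1 : 0 < w := hz0.trans hw.1
    have h2 : 0 < 1 - w := sub_pos.2 hw.2
    exact ⟨h1, h2, by positivity⟩
  have hpow : ∀ w ∈ Ioo z 1, φ w ^ α = T * (w / (1 - w)) := by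
    intro w hw
    rw [hφ]
    simp only
    rw [← Real.rpow_mul (hpos w hw).2.2.le, one_div_mul_cancel hα.ne', Real.rpow_one]
  have hder : ∀ w ∈ Ioo z 1, HasDerivWithinAt φ (φ' w) (Ioo z 1) w := by
    intro w hw
    obtain ⟨h1, h2, h3⟩ := hpos w hw
    have hd : HasDerivAt (fun w : ℝ => T * (w / (1 - w)))
        (T * ((1 * (1 - w) - w * (-1)) / (1 - w) ^ 2)) w :=
      ((hasDerivAt_id' w).div ((hasDerivAt_id' w).const_sub 1) h2.ne').const_mul T
    exact (hd.rpow_const (Or.inl h3.ne')).hasDerivWithinAt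
  have hinj : InjOn φ (Ioo z 1) := by
    intro w hw w' hw' h
    have h1 := hpow w hw
    rw [h, hpow w' hw'] at h1
    obtain ⟨-, h2, -⟩ := hpos w hw
    obtain ⟨-, h2', -⟩ := hpos w' hw'
    field_simp at h1
    linarith
  have himg : φ '' Ioo z 1 = Ioi 1 := by
    ext u
    constructor
    · rintro ⟨w, hw, rfl⟩
      obtain ⟨h1, h2, h3⟩ := hpos w hw
      refine Real.one_lt_rpow ?_ (by positivity)
      rw [← mul_div_assoc, one_lt_div h2]
      have : (1 + T) * z = 1 := by rw [hz]; field_simp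
      nlinarith [hw.1]
    · intro hu
      have hu : 1 < u := hu
      have hu0 : 0 < u := by linarith
      have hp : 1 < u ^ α := Real.one_lt_rpow hu hα
      refine ⟨u ^ α / (T + u ^ α), ⟨?_, ?_⟩, ?_⟩
      · rw [hz, inv_eq_one_div, div_lt_div_iff₀ (by linarith) (by linarith)]
        nlinarith
      · rw [div_lt_one (by linarith)]
        linarith
      · rw [hφ]
        have h1 : T * (u ^ α / (T + u ^ α) / (1 - u ^ α / (T + u ^ α))) = u ^ α := by
          have : T + u ^ α ≠ 0 := by linarith
          have h2 : 1 - u ^ α / (T + u ^ α) = T / (T + u ^ α) := by field_simp; ring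
          rw [h2]
          field_simp
        simp only [h1]
        rw [← Real.rpow_mul hu0.le, mul_one_div_cancel hα.ne', Real.rpow_one]
  have hcv := integral_image_eq_integral_abs_deriv_smul measurableSet_Ioo hder hinj
    fun u => u * (T / (T + u ^ α))
  rw [himg] at hcv
  have hpt : ∀ w ∈ Ioo z 1, |φ' w| • (φ w * (T / (T + φ w ^ α))) =
      (1 / α * T ^ (2 / α)) * (w ^ (2 / α - 1) * (1 - w) ^ (1 - 2 / α - 1)) := by
    intro w hw
    obtain ⟨h1, h2, h3⟩ := hpos w hw
    have hφ'0 : 0 ≤ φ' w := by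
      have : 1 * (1 - w) - w * (-1) = 1 := by ring
      simp only [hφ', this]
      positivity
    rw [abs_of_nonneg hφ'0, smul_eq_mul, hpow w hw]
    have hq : T / (T + T * (w / (1 - w))) = 1 - w := by field_simp; ring
    rw [hq]
    have e1 : φ w = (T * (w / (1 - w))) ^ (1 / α) := rfl
    have e2 : (T * (w / (1 - w))) ^ (1 / α - 1) * (T * (w / (1 - w))) ^ (1 / α) =
        T ^ (2 / α) * w ^ (2 / α) / (1 - w) ^ (2 / α) / (T * (w / (1 - w))) := by
      rw [← Real.rpow_add h3, show 1 / α - 1 + 1 / α = 2 / α - 1 by ring, Real.rpow_sub_one h3.ne',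
        Real.mul_rpow hT.le (by positivity), Real.div_rpow h1.le h2.le]
      ring
    have e3 : (1 - w) ^ (1 - 2 / α - 1) = ((1 - w) ^ (2 / α))⁻¹ := by
      rw [show 1 - 2 / α - 1 = -(2 / α) by ring, Real.rpow_neg h2.le]
    have e4 : w ^ (2 / α - 1) = w ^ (2 / α) / w := Real.rpow_sub_one h1.ne' _
    rw [e3, e4, e1]
    simp only [hφ']
    calc _ = T * ((1 * (1 - w) - w * (-1)) / (1 - w) ^ 2) * (1 / α) * (1 - w) *
          ((T * (w / (1 - w))) ^ (1 / α - 1) * (T * (w / (1 - w))) ^ (1 / α)) := by ring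
      _ = _ := by
        rw [e2]
        have : (1 - w) ^ (2 / α) ≠ 0 := (Real.rpow_pos_of_pos h2 _).ne'
        field_simp
        ring
  rw [setIntegral_congr_fun measurableSet_Ioo hpt, integral_const_mul] at hcv
  rw [tailIntegral, hcv, compIncBeta, intervalIntegral.integral_of_le hz1.le,
    integral_Ioc_eq_integral_Ioo]
  ring

/-- The mean factor that a point at relative distance `u` contributes, if it is excluded with
probability `p` up to distance `1` and interferes with probability `r` beyond. -/
def coverProfile (p r T α u : ℝ) : ℝ := if u ≤ 1 then 1 - p else 1 - r * (T / (T + u ^ α))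

section CoverProfile

variable {p r T α : ℝ}

/-- At the jump `u = 1` monotonicity rests on `r ≤ p`: exclusion costs at least as much as
interference, whose weight `T / (T + u ^ α)` is at most `1`. -/
lemma monotone_coverProfile (hr : 0 ≤ r) (hrp : r ≤ p) (hT : 0 ≤ T) (hα : 0 < α) :
    Monotone (coverProfile p r T α) := by
  intro u u' h
  unfold coverProfile
  split_ifs with h1 h2 h2
  · exact le_rfl
  · have hp : 0 < u' ^ α := Real.rpow_pos_of_pos (by linarith) α
    have : T / (T + u' ^ α) ≤ 1 := (div_le_one (by linarith)).2 (by linarith)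
    nlinarith
  · linarith
  · have hu : 0 < u := by linarith
    have hp : 0 < u ^ α := Real.rpow_pos_of_pos hu α
    have hpp : u ^ α ≤ u' ^ α := Real.rpow_le_rpow hu.le h hα.le
    have : T / (T + u' ^ α) ≤ T / (T + u ^ α) :=
      div_le_div_of_nonneg_left hT (by linarith) (by linarith)
    nlinarith

lemma coverProfile_le_one (hr : 0 ≤ r) (hrp : r ≤ p) (hT : 0 ≤ T) (u : ℝ) :
    coverProfile p r T α u ≤ 1 := by
  unfold coverProfile
  split_ifs with h
  · linarith
  · have hp : 0 < u ^ α := Real.rpow_pos_of_pos (by linarith) α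
    have : 0 ≤ r * (T / (T + u ^ α)) := by positivity
    linarith

lemma coverProfile_nonneg (hr : 0 ≤ r) (hrp : r ≤ p) (hp1 : p ≤ 1) (hT : 0 ≤ T) (u : ℝ) :
    0 ≤ coverProfile p r T α u := by
  unfold coverProfile
  split_ifs with h
  · linarith
  · have hp : 0 < u ^ α := Real.rpow_pos_of_pos (by linarith) α
    have : T / (T + u ^ α) ≤ 1 := (div_le_one (by linarith)).2 (by linarith)
    nlinarith

lemma setIntegral_coverProfile (hT : 0 ≤ T) (hα : 2 < α) :
    IntegrableOn (fun u => u * (1 - coverProfile p r T α u)) (Ioi 0) ∧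
      ∫ u in Ioi (0 : ℝ), u * (1 - coverProfile p r T α u) = p / 2 + r * tailIntegral T α := by
  have e1 : EqOn (fun u => u * p) (fun u => u * (1 - coverProfile p r T α u)) (Ioc 0 1) := by
    intro u hu
    simp [coverProfile, hu.2]
  have e2 : EqOn (fun u => r * (u * (T / (T + u ^ α))))
      (fun u => u * (1 - coverProfile p r T α u)) (Ioi 1) := by
    intro u hu
    have : ¬ u ≤ 1 := not_le.2 hu
    simp only [coverProfile, this, if_false]
    ring
  have h1 : IntegrableOn (fun u : ℝ => u * p) (Ioc 0 1) :=
    (Continuous.integrableOn_Ioc (by fun_prop))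
  have h1' := h1.congr_fun e1 measurableSet_Ioc
  have h2' := IntegrableOn.congr_fun ((integrableOn_tail hT hα).const_mul r) e2 measurableSet_Ioi
  rw [← Ioc_union_Ioi_eq_Ioi zero_le_one]
  refine ⟨h1'.union h2', ?_⟩
  rw [setIntegral_union (Ioc_disjoint_Ioi le_rfl) measurableSet_Ioi h1' h2',
    ← setIntegral_congr_fun measurableSet_Ioc e1, ← setIntegral_congr_fun measurableSet_Ioi e2,
    integral_const_mul, ← intervalIntegral.integral_of_le zero_le_one,
    intervalIntegral.integral_mul_const, integral_id, tailIntegral]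
  ring

lemma finrank_plane : Module.finrank ℝ Plane = 2 := by simp [Plane]

lemma integrable_coverProfile (hT : 0 ≤ T) (hα : 2 < α) :
    Integrable fun x : Plane => 1 - coverProfile p r T α ‖x‖ := by
  rw [integrable_fun_norm_addHaar (volume : Measure Plane) (f := fun u => 1 - coverProfile p r T α u),
    finrank_plane]
  simpa using (setIntegral_coverProfile hT hα).1

lemma integral_coverProfile (hT : 0 ≤ T) (hα : 2 < α) :
    ∫ x : Plane, (1 - coverProfile p r T α ‖x‖) =
      Real.pi * (p + r * (2 * tailIntegral T α)) := by
  rw [integral_fun_norm_addHaar (volume : Measure Plane) (fun u => 1 - coverProfile p r T α u),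
    finrank_plane]
  have h := (setIntegral_coverProfile (p := p) (r := r) hT hα).2
  have hb : volume.real (Metric.ball (0 : Plane) 1) = Real.pi := by
    rw [measureReal_def, EuclideanSpace.volume_ball_fin_two]
    simp [Real.pi_pos.le]
  simp only [Nat.add_one_sub_one, pow_one, smul_eq_mul, nsmul_eq_mul] at *
  rw [h, hb]
  push_cast
  ring

end CoverProfile

lemma betaCoeff_eq {W τ α : ℝ} {M g₀ : ℕ} (hα : 0 < α) (h : 0 < (M : ℝ) * g₀ * τ / W) :
    betaCoeff W τ α M g₀ = 2 * tailIntegral ((2 : ℝ) ^ ((M : ℝ) * g₀ * τ / W) - 1) α := by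
  have hT : 0 < (2 : ℝ) ^ ((M : ℝ) * g₀ * τ / W) - 1 :=
    sub_pos.2 (Real.one_lt_rpow (by norm_num) h)
  rw [tailIntegral_eq_compIncBeta hT hα, betaCoeff, Real.rpow_neg (by norm_num)]
  congr 3
  ring

/-! ### Coverage by a fixed group -/

/-- Base station `b`, of group `m`, is strictly nearer to the origin than all other base stations
with a group in `A`, and its signal exceeds `T` times the interference within its group. -/
def coverEvent {M : ℕ} (A : Finset (Fin M)) (m : Fin M) (T α : ℝ) (b : ℕ) :
    Set ((ℕ → Plane) × (ℕ → Fin M) × (ℕ → ℂ)) :=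
  {p | (p.2.1 b = m ∧ ∀ n, n ≠ b → ¬(p.2.1 n ∈ A ∧ ‖p.1 n‖ ≤ ‖p.1 b‖)) ∧
    ∑' n, (if n = b then 0 else ENNReal.ofReal
      ((if p.2.1 n = m then T * (‖p.1 b‖ ^ α * ‖p.1 n‖ ^ (-α)) else 0) * ‖p.2.2 n‖ ^ 2)) ≤
    ENNReal.ofReal (‖p.2.2 b‖ ^ 2)}

lemma measurableSet_coverEvent {M : ℕ} (A : Finset (Fin M)) (m : Fin M) (T α : ℝ) (b : ℕ) :
    MeasurableSet (coverEvent A m T α b) := by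
  have hg : ∀ n, Measurable fun p : (ℕ → Plane) × (ℕ → Fin M) × (ℕ → ℂ) => p.2.1 n :=
    fun n => by fun_prop
  have hgm : ∀ n (s : Set (Fin M)),
      MeasurableSet {p : (ℕ → Plane) × (ℕ → Fin M) × (ℕ → ℂ) | p.2.1 n ∈ s} :=
    fun n s => hg n (MeasurableSet.of_discrete (s := s))
  refine MeasurableSet.inter (MeasurableSet.inter (hgm b {m}) ?_) ?_
  · change MeasurableSet {p : (ℕ → Plane) × (ℕ → Fin M) × (ℕ → ℂ) |
      ∀ n, n ≠ b → ¬(p.2.1 n ∈ A ∧ ‖p.1 n‖ ≤ ‖p.1 b‖)}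
    simp only [ofPred_forall]
    refine MeasurableSet.iInter fun n => MeasurableSet.iInter fun _ => ?_
    have hnorm : ∀ n, Measurable fun p : (ℕ → Plane) × (ℕ → Fin M) × (ℕ → ℂ) => ‖p.1 n‖ :=
      fun n => by fun_prop
    exact ((hgm n A).inter (measurableSet_le (hnorm n) (hnorm b))).compl
  · have hsig : Measurable fun p : (ℕ → Plane) × (ℕ → Fin M) × (ℕ → ℂ) =>
        ENNReal.ofReal (‖p.2.2 b‖ ^ 2) := by fun_prop
    refine measurableSet_le (Measurable.tsum fun n => ?_) hsig
    by_cases hn : n = b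
    · simp [hn]
    · simp only [hn, if_false]
      have hw : Measurable fun p : (ℕ → Plane) × (ℕ → Fin M) × (ℕ → ℂ) =>
          if p.2.1 n = m then T * (‖p.1 b‖ ^ α * ‖p.1 n‖ ^ (-α)) else 0 :=
        Measurable.ite (hgm n {m}) (by fun_prop) measurable_const
      exact (hw.mul (by fun_prop)).ennreal_ofReal

/-- Each of two such stations would have to be strictly nearer than the other, as both groups equal
`m ∈ A`. -/
lemma pairwise_disjoint_coverEvent {M : ℕ} {A : Finset (Fin M)} {m : Fin M} (hm : m ∈ A)
    (T α : ℝ) : Pairwise fun b b' => Disjoint (coverEvent A m T α b) (coverEvent A m T α b') := by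
  intro b b' hbb
  rw [Set.disjoint_left]
  rintro p ⟨⟨h1, h2⟩, -⟩ ⟨⟨h3, h4⟩, -⟩
  have h5 := h2 b' hbb.symm
  have h6 := h4 b hbb
  rw [h3] at h5
  rw [h1] at h6
  simp only [hm, true_and, not_le] at h5 h6
  exact lt_asymm h5 h6

namespace IsNetwork

variable {Ω : Type*} [MeasurableSpace Ω] {P : Measure Ω} {lam : ℝ} {M : ℕ} {X : ℕ → Ω → Plane}
  {grp : ℕ → Ω → Fin M} {h : ℕ → Ω → ℂ}

lemma lintegral_grp (hnet : IsNetwork P lam X grp h) (hM : 0 < M) (n : ℕ) {F : Fin M → ℝ}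
    (hF : ∀ g, 0 ≤ F g) :
    ∫⁻ ω, ENNReal.ofReal (F (grp n ω)) ∂P = ENNReal.ofReal ((∑ g, F g) / M) := by
  have hMr : (0 : ℝ) < M := by exact_mod_cast hM
  rw [← lintegral_map (μ := P) (f := fun g => ENNReal.ofReal (F g)) Measurable.of_discrete
    (hnet.grp_measurable n), lintegral_fintype, div_eq_mul_inv,
    ENNReal.ofReal_mul (Finset.sum_nonneg fun g _ => hF g),
    ENNReal.ofReal_sum_of_nonneg fun g _ => hF g, Finset.sum_mul]
  refine Finset.sum_congr rfl fun g _ => ?_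
  rw [Measure.map_apply (hnet.grp_measurable n) (measurableSet_singleton g)]
  change _ * P {ω | grp n ω = g} = _
  rw [hnet.grp_uniform, ENNReal.ofReal_inv_of_pos hMr, ENNReal.ofReal_natCast]

/-- The mean contribution of one base station at distance `s` to the success probability of a
serving base station of group `m` at distance `r`. -/
lemma lintegral_factor (hnet : IsNetwork P lam X grp h) (n : ℕ)
    {A : Finset (Fin M)} {m : Fin M} (hm : m ∈ A) {T α : ℝ} (hT : 0 ≤ T) {r s : ℝ}
    (hr : 0 < r) (hs : 0 ≤ s) :
    ∫⁻ ω, ENNReal.ofReal (if grp n ω ∈ A ∧ s ≤ r then 0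
        else 1 / (1 + if grp n ω = m then T * (r ^ α * s ^ (-α)) else 0)) ∂P =
      ENNReal.ofReal (coverProfile (A.card / M) (1 / M) T α (s / r)) := by
  have hM : 0 < M := m.pos
  have hMr : (0 : ℝ) < M := by exact_mod_cast hM
  have hc : 0 ≤ T * (r ^ α * s ^ (-α)) := by positivity
  rw [hnet.lintegral_grp hM n (F := fun g => if g ∈ A ∧ s ≤ r then 0
        else 1 / (1 + if g = m then T * (r ^ α * s ^ (-α)) else 0))
    (fun g => by split_ifs <;> positivity)]
  congr 1
  by_cases hsr : s ≤ r
  · rw [coverProfile, if_pos ((div_le_one hr).2 hsr)]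
    have : ∀ g : Fin M, (if g ∈ A ∧ s ≤ r then (0 : ℝ)
        else 1 / (1 + if g = m then T * (r ^ α * s ^ (-α)) else 0)) = 1 - if g ∈ A then 1 else 0 := by
      intro g
      by_cases hg : g ∈ A
      · simp [hg, hsr]
      · have : g ≠ m := fun h => hg (h ▸ hm)
        simp [hg, this]
    simp_rw [this]
    rw [Finset.sum_sub_distrib]
    simp
    field_simp
  · have hsr' : r < s := not_le.1 hsr
    have hs0 : 0 < s := hr.trans hsr'
    rw [coverProfile, if_neg (by rw [div_le_one hr]; exact hsr)]
    have hc' : 0 < 1 + T * (r ^ α * s ^ (-α)) := by positivity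
    have : ∀ g : Fin M, (if g ∈ A ∧ s ≤ r then (0 : ℝ)
        else 1 / (1 + if g = m then T * (r ^ α * s ^ (-α)) else 0)) =
        1 - if g = m then T / (T + (s / r) ^ α) else 0 := by
      intro g
      rw [if_neg fun h => hsr h.2]
      by_cases hg : g = m
      · simp only [hg, if_true]
        have h1 : 0 < r ^ α := Real.rpow_pos_of_pos hr α
        have h2 : 0 < s ^ α := Real.rpow_pos_of_pos hs0 α
        rw [Real.div_rpow hs hr.le, Real.rpow_neg hs]
        have h3 : T + s ^ α / r ^ α ≠ 0 := by positivity
        have h4 : 1 + T * (r ^ α * (s ^ α)⁻¹) ≠ 0 := by positivity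
        field_simp
        ring
      · simp [hg]
    simp_rw [this]
    rw [Finset.sum_sub_distrib]
    simp
    field_simp

/-- Integrate out the fading first, then the groups. The nearest-station constraint and the fading
probability are both products over stations of functions of their own groups, so independence of the
groups factorises the mean. -/
lemma measure_coverEvent_fixed (hnet : IsNetwork P lam X grp h) {A : Finset (Fin M)} {m : Fin M}
    (hm : m ∈ A) {T α : ℝ} (hT : 0 ≤ T) {x : ℕ → Plane} {b : ℕ} (hb : x b ≠ 0) :
    P {ω | (x, (fun n => grp n ω), fun n => h n ω) ∈ coverEvent A m T α b} =
      (M : ℝ≥0∞)⁻¹ * relativeProd (coverProfile (A.card / M) (1 / M) T α) x b := by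
  classical
  have hind := hnet.grp_iIndep
  have := hind.isProbabilityMeasure
  have hM : 0 < M := m.pos
  have hr : 0 < ‖x b‖ := norm_pos_iff.2 hb
  have hgm : Measurable fun ω n => grp n ω := measurable_pi_iff.2 hnet.grp_measurable
  have hhm : Measurable fun ω n => h n ω := measurable_pi_iff.2 hnet.fading_measurable
  have hE : MeasurableSet {p : (ℕ → Fin M) × (ℕ → ℂ) | (x, p.1, p.2) ∈ coverEvent A m T α b} :=
    measurable_prodMk_left (measurableSet_coverEvent A m T α b)
  change P ((fun ω => ((fun n => grp n ω), fun n => h n ω)) ⁻¹'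
    {p : (ℕ → Fin M) × (ℕ → ℂ) | (x, p.1, p.2) ∈ coverEvent A m T α b}) = _
  rw [← Measure.map_apply (hgm.prodMk hhm) hE,
    (indepFun_iff_map_prod_eq_prod_map_map hgm.aemeasurable hhm.aemeasurable).1
      hnet.grp_fading_indep, Measure.prod_apply hE,
    lintegral_map (measurable_measure_prodMk_left hE) hgm]
  set s : (ℕ → Fin M) → ℕ → ℝ := fun g n =>
    if g n = m then T * (‖x b‖ ^ α * ‖x n‖ ^ (-α)) else 0 with hs
  have hs0 : ∀ g n, 0 ≤ s g n := fun g n => by simp only [hs]; split_ifs <;> positivity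
  -- The factor of station `n` in group `γ`: an indicator of the right group at `b`; elsewhere `0`
  -- if the station violates the nearest-station constraint, and otherwise its Laplace factor.
  set Y : ℕ → Fin M → ℝ≥0∞ := fun n γ =>
    if n = b then ENNReal.ofReal (if γ = m then 1 else 0) else
      ENNReal.ofReal (if γ ∈ A ∧ ‖x n‖ ≤ ‖x b‖ then 0
        else 1 / (1 + if γ = m then T * (‖x b‖ ^ α * ‖x n‖ ^ (-α)) else 0)) with hY
  have hY1 : ∀ n γ, Y n γ ≤ 1 := by
    intro n γ
    have hc : 0 ≤ T * (‖x b‖ ^ α * ‖x n‖ ^ (-α)) := by positivity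
    simp only [hY]
    split_ifs <;> simp only [ENNReal.ofReal_le_one] <;> try norm_num
    exact inv_le_one_of_one_le₀ (by linarith)
  have hsec : ∀ ω, P.map (fun ω n => h n ω) (Prod.mk (fun n => grp n ω) ⁻¹'
      {p : (ℕ → Fin M) × (ℕ → ℂ) | (x, p.1, p.2) ∈ coverEvent A m T α b}) =
      infProd fun n => Y n (grp n ω) := by
    intro ω
    rw [Measure.map_apply hhm (measurable_prodMk_left hE)]
    by_cases hQ : grp b ω = m ∧ ∀ n, n ≠ b → ¬(grp n ω ∈ A ∧ ‖x n‖ ≤ ‖x b‖)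
    · have hset : (fun ω n => h n ω) ⁻¹' (Prod.mk (fun n => grp n ω) ⁻¹'
          {p : (ℕ → Fin M) × (ℕ → ℂ) | (x, p.1, p.2) ∈ coverEvent A m T α b}) =
          {ω' | ∑' n, (if n = b then 0 else
            ENNReal.ofReal (s (fun n => grp n ω) n * ‖h n ω'‖ ^ 2)) ≤
            ENNReal.ofReal (‖h b ω'‖ ^ 2)} := by
        ext ω'
        exact and_iff_right hQ
      rw [hset, fading_infinite hnet.fading_measurable hnet.fading_law hnet.fading_iIndep (hs0 _) b]
      congr 1
      ext n
      by_cases hn : n = b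
      · simp [hY, hn, hQ.1]
      · simp only [hY, hn, if_false, hQ.2 n hn, hs]
    · have hset : (fun ω n => h n ω) ⁻¹' (Prod.mk (fun n => grp n ω) ⁻¹'
          {p : (ℕ → Fin M) × (ℕ → ℂ) | (x, p.1, p.2) ∈ coverEvent A m T α b}) = ∅ := by
        ext ω'
        simp only [mem_empty_iff_false, iff_false]
        exact fun h => hQ h.1
      rw [hset, measure_empty]
      symm
      rw [not_and_or] at hQ
      rcases hQ with hQ | hQ
      · exact infProd_eq_zero (n := b) (by simp [hY, hQ])
      · push Not at hQ
        obtain ⟨n, hn, hnA⟩ := hQ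
        exact infProd_eq_zero (n := n) (by simp [hY, hn, hnA])
  simp_rw [hsec]
  rw [lintegral_infProd (Y := fun n ω => Y n (grp n ω))
    (fun n => (Measurable.of_discrete (f := Y n)).comp (hnet.grp_measurable n))
    (fun n ω => hY1 n _) (hind.comp Y fun n => Measurable.of_discrete)]
  -- Station `b` contributes the probability `1 / M` of being in group `m`; splitting off this
  -- single factor leaves `relativeProd`.
  have hMinv : (M : ℝ≥0∞)⁻¹ ≤ 1 := ENNReal.inv_le_one.2 (by exact_mod_cast hM)
  have hfac : ∀ n, ∫⁻ ω, Y n (grp n ω) ∂P = (if n = b then (M : ℝ≥0∞)⁻¹ else 1) *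
      (if n = b then 1 else ENNReal.ofReal
        (coverProfile (A.card / M) (1 / M) T α (‖x n‖ / ‖x b‖))) := by
    intro n
    by_cases hn : n = b
    · simp only [hY, hn, if_true]
      rw [hnet.lintegral_grp hM b (F := fun γ => if γ = m then 1 else 0)
        (fun γ => by split_ifs <;> norm_num)]
      have hMr : (0 : ℝ) < M := by exact_mod_cast hM
      simp [ENNReal.ofReal_inv_of_pos hMr]
    · simp only [hY, hn, if_false]
      rw [hnet.lintegral_factor n hm hT hr (norm_nonneg _), one_mul]
  have hcard : (A.card : ℝ) / M ≤ 1 := by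
    rw [div_le_one (by exact_mod_cast hM)]
    exact_mod_cast (Finset.card_le_univ A).trans_eq (Fintype.card_fin M)
  have hpos : 1 / (M : ℝ) ≤ A.card / M := by
    gcongr
    exact_mod_cast Finset.card_pos.2 ⟨m, hm⟩
  simp_rw [hfac]
  rw [infProd_mul, infProd_single b hMinv]
  · rfl
  · intro n; split_ifs <;> simp [hMinv]
  · intro n
    split_ifs
    · exact le_rfl
    · exact ENNReal.ofReal_le_one.2 (coverProfile_le_one (by positivity) hpos hT _)

/-- The joint probability that the typical user is served by group `m` and that its signal exceeds
`T` times the interference. -/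
theorem measure_iUnion_coverEvent (hnet : IsNetwork P lam X grp h) (hlam : 0 < lam)
    {A : Finset (Fin M)} {m : Fin M} (hm : m ∈ A) {T α : ℝ} (hT : 0 ≤ T) (hα : 2 < α) :
    P {ω | ((fun n => X n ω), (fun n => grp n ω), fun n => h n ω) ∈
        ⋃ b, coverEvent A m T α b} = ENNReal.ofReal (1 / (A.card + 2 * tailIntegral T α)) := by
  have := hnet.grp_iIndep.isProbabilityMeasure
  have hM : 0 < M := m.pos
  have hMr : (0 : ℝ) < M := by exact_mod_cast hM
  have hcard : (A.card : ℝ) / M ≤ 1 := by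
    rw [div_le_one hMr]
    exact_mod_cast (Finset.card_le_univ A).trans_eq (Fintype.card_fin M)
  have hA1 : (1 : ℝ) ≤ A.card := by exact_mod_cast Finset.card_pos.2 ⟨m, hm⟩
  have hpos : 1 / (M : ℝ) ≤ A.card / M := by gcongr
  have hr0 : (0 : ℝ) ≤ 1 / M := by positivity
  have hXm : Measurable fun ω n => X n ω := measurable_pi_iff.2 hnet.position_ppp.measurable
  have hgm : Measurable fun ω n => grp n ω := measurable_pi_iff.2 hnet.grp_measurable
  have hhm : Measurable fun ω n => h n ω := measurable_pi_iff.2 hnet.fading_measurable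
  have hind : IndepFun (fun ω n => X n ω) (fun ω => ((fun n => grp n ω), fun n => h n ω)) P :=
    hnet.position_marks_indep.comp (φ := id)
      (ψ := fun y : ℕ → Fin M × ℂ => ((fun n => (y n).1), fun n => (y n).2)) measurable_id
      (by fun_prop)
  have hE := measurableSet_coverEvent A m T α
  have hmap := (indepFun_iff_map_prod_eq_prod_map_map hXm.aemeasurable
    (hgm.prodMk hhm).aemeasurable).1 hind
  have hb : ∀ b, P {ω | ((fun n => X n ω), (fun n => grp n ω), fun n => h n ω) ∈
      coverEvent A m T α b} = ∫⁻ ω, (M : ℝ≥0∞)⁻¹ *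
        relativeProd (coverProfile (A.card / M) (1 / M) T α) (fun n => X n ω) b ∂P := by
    intro b
    change P ((fun ω => ((fun n => X n ω), (fun n => grp n ω), fun n => h n ω)) ⁻¹' _) = _
    rw [← Measure.map_apply (hXm.prodMk (hgm.prodMk hhm)) (hE b), hmap, Measure.prod_apply (hE b),
      lintegral_map (measurable_measure_prodMk_left (hE b)) hXm]
    refine lintegral_congr_ae ?_
    filter_upwards [hnet.position_ppp.ae_ne_zero] with ω hω
    rw [Measure.map_apply (hgm.prodMk hhm) (measurable_prodMk_left (hE b))]
    exact hnet.measure_coverEvent_fixed hm hT (hω b)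
  have hmono := monotone_coverProfile hr0 hpos hT (show 0 < α by linarith)
  have hrel : ∀ b, Measurable fun ω =>
      relativeProd (coverProfile (A.card / M) (1 / M) T α) (fun n => X n ω) b := by
    intro b
    refine measurable_infProd fun n => ?_
    have h1 := hnet.position_ppp.measurable n
    have h2 := hnet.position_ppp.measurable b
    split_ifs
    · exact measurable_const
    · exact (hmono.measurable.comp (h1.norm.div h2.norm)).ennreal_ofReal
  have hI := integral_coverProfile (p := A.card / M) (r := 1 / M) hT hα
  have htail := tailIntegral_nonneg hT α
  have hIpos : 0 < ∫ x : Plane, (1 - coverProfile (A.card / M) (1 / M) T α ‖x‖) := by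
    rw [hI]
    have := Real.pi_pos
    positivity
  have hset : {ω | ((fun n => X n ω), (fun n => grp n ω), fun n => h n ω) ∈
      ⋃ b, coverEvent A m T α b} =
      ⋃ b, {ω | ((fun n => X n ω), (fun n => grp n ω), fun n => h n ω) ∈ coverEvent A m T α b} := by
    ext ω
    simp only [mem_ofPred_eq, mem_iUnion]
  rw [hset, measure_iUnion]
  · simp_rw [hb]
    rw [← lintegral_tsum fun b => ((hrel b).const_mul _).aemeasurable]
    simp_rw [ENNReal.tsum_mul_left]
    rw [lintegral_const_mul _ (Measurable.tsum hrel),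
      hnet.position_ppp.lintegral_tsum_relativeProd hlam hmono
        (coverProfile_nonneg hr0 hpos hcard hT) (coverProfile_le_one hr0 hpos hT)
        (integrable_coverProfile hT hα) hIpos, hI, ← ENNReal.ofReal_natCast,
      ← ENNReal.ofReal_inv_of_pos hMr, ← ENNReal.ofReal_mul (by positivity)]
    congr 1
    have := Real.pi_pos
    field_simp
  · intro b b' hbb
    exact Disjoint.preimage _ (pairwise_disjoint_coverEvent hm T α hbb)
  · intro b
    exact (hXm.prodMk (hgm.prodMk hhm)) (hE b)

/-- Almost surely there is a strictly nearest base station with a group in `A`. -/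
lemma ae_exists_nearest (hnet : IsNetwork P lam X grp h) (hlam : 0 < lam) {A : Finset (Fin M)}
    (hA : A.Nonempty) :
    ∀ᵐ ω ∂P, ∃ b, grp b ω ∈ A ∧ ∀ n, n ≠ b → grp n ω ∈ A → ‖X b ω‖ < ‖X n ω‖ := by
  have := hnet.grp_iIndep.isProbabilityMeasure
  have hXm : Measurable fun ω n => X n ω := measurable_pi_iff.2 hnet.position_ppp.measurable
  have hgm : Measurable fun ω n => grp n ω := measurable_pi_iff.2 hnet.grp_measurable
  have hhm : Measurable fun ω n => h n ω := measurable_pi_iff.2 hnet.fading_measurable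
  set S : Fin M → Set Ω := fun m => {ω | ((fun n => X n ω), (fun n => grp n ω), fun n => h n ω) ∈
    ⋃ b, coverEvent A m 0 3 b} with hS
  have hSm : ∀ m, MeasurableSet (S m) := fun m => (hXm.prodMk (hgm.prodMk hhm))
    (MeasurableSet.iUnion fun b => measurableSet_coverEvent A m 0 3 b)
  have hdis : (A : Set (Fin M)).PairwiseDisjoint S := by
    intro m hm m' hm' hmm
    rw [Function.onFun, Set.disjoint_left]
    intro ω hω hω'
    simp only [hS, mem_ofPred_eq, mem_iUnion] at hω hω'
    obtain ⟨b, ⟨h1, h2⟩, -⟩ := hω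
    obtain ⟨b', ⟨h3, h4⟩, -⟩ := hω'
    simp only at h1 h2 h3 h4
    have hbb : b ≠ b' := by
      rintro rfl
      exact hmm (h1.symm.trans h3)
    have h5 := h2 b' hbb.symm
    have h6 := h4 b hbb
    rw [h3] at h5
    rw [h1] at h6
    rw [not_and, not_le] at h5 h6
    exact lt_asymm (h5 hm') (h6 hm)
  -- At `T = 0` the interference constraint is void, so the disjoint events have probability `1 /
  -- |A|` each and exhaust the space. The exponent `3` is an arbitrary choice above `2`.
  have hone : P (⋃ m ∈ A, S m) = 1 := by
    rw [measure_biUnion_finset hdis fun m _ => hSm m]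
    have : ∀ m ∈ A, P (S m) = ENNReal.ofReal (1 / A.card) := by
      intro m hm
      rw [hS, hnet.measure_iUnion_coverEvent hlam hm le_rfl (by norm_num), tailIntegral_zero]
      simp
    have hc : (A.card : ℝ) ≠ 0 := by exact_mod_cast hA.card_pos.ne'
    rw [Finset.sum_congr rfl this, Finset.sum_const, nsmul_eq_mul, ← ENNReal.ofReal_natCast,
      ← ENNReal.ofReal_mul (by positivity), mul_one_div_cancel hc, ENNReal.ofReal_one]
  have hae : ∀ᵐ ω ∂P, ω ∈ ⋃ m ∈ A, S m :=
    (prob_compl_eq_zero_iff (Finset.measurableSet_biUnion A fun m _ => hSm m)).2 hone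
  filter_upwards [hae] with ω hω
  simp only [mem_iUnion] at hω
  obtain ⟨m, hm, hω⟩ := hω
  simp only [hS, mem_ofPred_eq, mem_iUnion] at hω
  obtain ⟨b, ⟨h1, h2⟩, -⟩ := hω
  simp only at h1 h2
  exact ⟨b, h1 ▸ hm, fun n hn hnA => not_le.1 fun hle => h2 n hn ⟨hnA, hle⟩⟩

end IsNetwork

/-! ### Cache placement, serving station and rate threshold -/

open Classical in
/-- The groups whose base stations have access to file `l`. -/
def accessGroups {L : ℕ} (M : ℕ) (q : Fin L → ℕ) (l : Fin L) : Finset (Fin M) :=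
  Finset.univ.filter fun m => HasAccess q l m

lemma mem_accessGroups {L M : ℕ} {q : Fin L → ℕ} {l : Fin L} {m : Fin M} :
    m ∈ accessGroups M q l ↔ HasAccess q l m := by simp [accessGroups]

/-- The offsets `j < q l ≤ M` stay distinct modulo `M` after a common shift. -/
lemma card_cacheGroups {L M : ℕ} (hM : 0 < M) (q : Fin L → ℕ) (l : Fin L) (hq : q l ≤ M) :
    (cacheGroups M q l).card = q l := by
  set s := ∑ l' with l' < l, q l' with hs
  have himg : (cacheGroups M q l).map Fin.valEmbedding =
      (Finset.range (q l)).image fun j => (s + j) % M := by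
    ext i
    simp only [cacheGroups, Finset.mem_map, Finset.mem_filter, Finset.mem_univ, true_and,
      Finset.mem_image, Fin.valEmbedding_apply]
    constructor
    · rintro ⟨m, ⟨j, hj, hm⟩, rfl⟩
      exact ⟨j, hj, hm.symm⟩
    · rintro ⟨j, hj, rfl⟩
      exact ⟨⟨(s + j) % M, Nat.mod_lt _ hM⟩, ⟨j, hj, rfl⟩, rfl⟩
  rw [← Finset.card_map Fin.valEmbedding, himg, Finset.card_image_of_injOn, Finset.card_range]
  intro j hj j' hj' h
  have hj := Finset.mem_range.1 hj
  have hj' := Finset.mem_range.1 hj'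
  exact Nat.ModEq.eq_of_lt_of_lt (Nat.ModEq.add_left_cancel' s h) (by omega) (by omega)

lemma card_accessGroups {L M : ℕ} (hM : 0 < M) (q : Fin L → ℕ) (l : Fin L) (hq : q l ≤ M) :
    (accessGroups M q l).card = if q l = 0 then M else q l := by
  split_ifs with h
  · have : accessGroups M q l = Finset.univ := by
      ext m
      simp [mem_accessGroups, HasAccess, h]
    rw [this, Finset.card_univ, Fintype.card_fin]
  · have : accessGroups M q l = cacheGroups M q l := by
      ext m
      simp [mem_accessGroups, HasAccess, h]
    rw [this, card_cacheGroups hM q l hq]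

lemma accessGroups_nonempty {L M : ℕ} (hM : 0 < M) (q : Fin L → ℕ) (l : Fin L) (hq : q l ≤ M) :
    (accessGroups M q l).Nonempty := by
  rw [← Finset.card_pos, card_accessGroups hM q l hq]
  split_ifs with h <;> omega

lemma accessDensity_div_interfererDensity {L M : ℕ} (hM : 0 < M) (q : Fin L → ℕ) (l : Fin L)
    (hq : q l ≤ M) {lam : ℝ} (hlam : 0 < lam) :
    accessDensity lam M q l / interfererDensity lam M = (accessGroups M q l).card := by
  have hMr : (0 : ℝ) < M := by exact_mod_cast hM
  rw [card_accessGroups hM q l hq, accessDensity, interfererDensity]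
  split_ifs <;> field_simp

/-- Some base station of group `m` is the strictly nearest one with a group in `A`, and its signal
exceeds `T` times the interference within its group. -/
def groupCover {M : ℕ} (A : Finset (Fin M)) (m : Fin M) (T α : ℝ) :
    Set ((ℕ → Plane) × (ℕ → Fin M) × (ℕ → ℂ)) :=
  {p | m ∈ A ∧ ∃ b, p ∈ coverEvent A m T α b}

lemma groupCover_of_mem {M : ℕ} {A : Finset (Fin M)} {m : Fin M} (hm : m ∈ A) (T α : ℝ) :
    groupCover A m T α = ⋃ b, coverEvent A m T α b := by
  ext p
  simp [groupCover, hm]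

lemma groupCover_of_notMem {M : ℕ} {A : Finset (Fin M)} {m : Fin M} (hm : m ∉ A) (T α : ℝ) :
    groupCover A m T α = ∅ := by
  ext p
  simp [groupCover, hm]

lemma measurableSet_groupCover {M : ℕ} (A : Finset (Fin M)) (m : Fin M) (T α : ℝ) :
    MeasurableSet (groupCover A m T α) := by
  by_cases hm : m ∈ A
  · rw [groupCover_of_mem hm]
    exact MeasurableSet.iUnion fun b => measurableSet_coverEvent A m T α b
  · rw [groupCover_of_notMem hm]
    exact MeasurableSet.empty

/-- A strict minimiser makes the set of nearest stations a singleton, so the infimum in `servingBS`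
makes no choice. -/
lemma servingBS_eq {L M : ℕ} {q : Fin L → ℕ} {l : Fin L} {x : ℕ → Plane} {g : ℕ → Fin M} {b : ℕ}
    (hb : g b ∈ accessGroups M q l)
    (hlt : ∀ n, n ≠ b → g n ∈ accessGroups M q l → ‖x b‖ < ‖x n‖) : servingBS q l x g = b := by
  simp only [mem_accessGroups] at hb hlt
  have hset : {n | IsNearest q l x g n} = {b} := by
    ext n
    rw [mem_ofPred_eq, mem_singleton_iff]
    constructor
    · rintro ⟨h1, h2⟩
      by_contra hn
      exact absurd (h2 b hb) (not_le.2 (hlt n hn h1))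
    · rintro rfl
      refine ⟨hb, fun n' hn' => ?_⟩
      by_cases h : n' = n
      · rw [h]
      · exact (hlt n' h hn').le
  rw [servingBS, hset, csInf_singleton]

/-- Clearing the denominator. If the interference is infinite, `toReal` makes it `0` and the
quotient `0`, so both sides fail because `0 < T`. Zero interference has to be excluded, since the
quotient would again be `0`. -/
lemma le_sir_iff {M : ℕ} {α T : ℝ} (hT : 0 < T) {x : ℕ → Plane} {g : ℕ → Fin M} {h : ℕ → ℂ} {b : ℕ}
    (hx : x b ≠ 0) (hI : interference α x g h b ≠ 0) :
    T ≤ sir α x g h b ↔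
      ∑' n, (if n = b then 0 else ENNReal.ofReal
        ((if g n = g b then T * (‖x b‖ ^ α * ‖x n‖ ^ (-α)) else 0) * ‖h n‖ ^ 2)) ≤
      ENNReal.ofReal (‖h b‖ ^ 2) := by
  have hr : 0 < ‖x b‖ ^ α := Real.rpow_pos_of_pos (norm_pos_iff.2 hx) α
  have hsum : ∑' n, (if n = b then 0 else ENNReal.ofReal
        ((if g n = g b then T * (‖x b‖ ^ α * ‖x n‖ ^ (-α)) else 0) * ‖h n‖ ^ 2)) =
      ENNReal.ofReal (T * ‖x b‖ ^ α) * interference α x g h b := by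
    rw [interference, ← ENNReal.tsum_mul_left]
    refine tsum_congr fun n => ?_
    by_cases hn : n = b
    · simp [hn]
    · by_cases hg : g n = g b
      · simp only [hn, hg, ne_eq, not_false_eq_true, and_self, if_true, if_false]
        rw [← ENNReal.ofReal_mul (by positivity)]
        congr 1
        ring
      · simp [hn, hg]
  rw [hsum, sir]
  by_cases htop : interference α x g h b = ∞
  · have h0 : 0 < T * ‖x b‖ ^ α := by positivity
    simp [htop, ENNReal.mul_top, h0, hT]
  · have hIpos : 0 < (interference α x g h b).toReal := ENNReal.toReal_pos hI htop
    rw [le_div_iff₀ hIpos]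
    conv_rhs => rw [← ENNReal.ofReal_toReal htop]
    rw [← ENNReal.ofReal_mul (by positivity), ENNReal.ofReal_le_ofReal_iff (sq_nonneg _),
      Real.rpow_neg (norm_nonneg _), ← div_eq_inv_mul, le_div_iff₀ hr, mul_right_comm]

lemma sir_nonneg {M : ℕ} (α : ℝ) (x : ℕ → Plane) (g : ℕ → Fin M) (h : ℕ → ℂ) (b : ℕ) :
    0 ≤ sir α x g h b := by
  unfold sir
  positivity

lemma le_achievableRate_iff {L M : ℕ} (hM : 0 < M) (q : Fin L → ℕ) (BB : ℕ) {W τ : ℝ} (α : ℝ)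
    (hW : 0 < W) (k : Fin L → ℕ) (hk : 0 < servedUsers q BB k) (l : Fin L) (x : ℕ → Plane)
    (g : ℕ → Fin M) (h : ℕ → ℂ) :
    τ ≤ achievableRate q BB W α k l x g h ↔
      (2 : ℝ) ^ ((M : ℝ) * servedUsers q BB k * τ / W) - 1 ≤
        sir α x g h (servingBS q l x g) := by
  have hMr : (0 : ℝ) < M := by exact_mod_cast hM
  have hkr : (0 : ℝ) < servedUsers q BB k := by exact_mod_cast hk
  have h0 := sir_nonneg α x g h (servingBS q l x g)
  rw [sub_le_iff_le_add', ← Real.le_logb_iff_rpow_le (by norm_num) (by linarith), achievableRate,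
    div_le_iff₀ hW, div_mul_eq_mul_div, le_div_iff₀ (by positivity)]
  rw [mul_comm τ, mul_comm W]

/-- The typical user itself is served: it counts in the first sum if its file is cached, and
otherwise makes both the number of backhaul users and `BB` positive. -/
lemma servedUsers_pos {L : ℕ} {q : Fin L → ℕ} {BB : ℕ} {k : Fin L → ℕ} {l : Fin L} {j : ℕ}
    (hk : 1 ≤ k l) (hs : IsScheduled q BB l j) : 0 < servedUsers q BB k := by
  unfold servedUsers
  by_cases hl : q l = 0
  · have hj : j < BB := hs.resolve_left fun h => h hl
    have h1 : k l ≤ ∑ l with q l = 0, k l :=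
      Finset.single_le_sum (f := k) (fun _ _ => Nat.zero_le _) (by simp [hl])
    have : 0 < min (∑ l with q l = 0, k l) BB := lt_min (by omega) (by omega)
    omega
  · have h1 : k l ≤ ∑ l with q l ≠ 0, k l :=
      Finset.single_le_sum (f := k) (fun _ _ => Nat.zero_le _) (by simp [hl])
    omega

/-! ### Almost sure properties of the network -/

namespace IsNetwork

variable {Ω : Type*} [MeasurableSpace Ω] {P : Measure Ω} {lam : ℝ} {M : ℕ} {X : ℕ → Ω → Plane}
  {grp : ℕ → Ω → Fin M} {h : ℕ → Ω → ℂ}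

/-- Second Borel–Cantelli lemma: independent events of constant probability `1 / M`. -/
lemma ae_frequently_grp (hnet : IsNetwork P lam X grp h) :
    ∀ᵐ ω ∂P, ∀ m, ∃ᶠ n in atTop, grp n ω = m := by
  have := hnet.grp_iIndep.isProbabilityMeasure
  rw [ae_all_iff]
  intro m
  have hms : ∀ n, MeasurableSet {ω | grp n ω = m} :=
    fun n => hnet.grp_measurable n (measurableSet_singleton m)
  have hind : iIndepSet (fun n => {ω | grp n ω = m}) P := by
    rw [iIndepSet_iff_meas_biInter hms]
    intro s
    exact hnet.grp_iIndep.measure_inter_preimage_eq_mul s (sets := fun _ => {m})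
      fun _ _ => measurableSet_singleton m
  have hsum : ∑' n, P {ω | grp n ω = m} = ∞ := by
    simp_rw [hnet.grp_uniform]
    exact ENNReal.tsum_const_eq_top_of_ne_zero (by simp)
  have hae : ∀ᵐ ω ∂P, ω ∈ limsup (fun n => {ω | grp n ω = m}) atTop :=
    (prob_compl_eq_zero_iff (MeasurableSet.measurableSet_limsup hms)).2
      (measure_limsup_eq_one hms hind hsum)
  filter_upwards [hae] with ω hω
  exact (mem_limsup_iff_frequently_mem (s := fun n => {ω | grp n ω = m})).1 hω

lemma ae_fading_ne_zero (hnet : IsNetwork P lam X grp h) : ∀ᵐ ω ∂P, ∀ n, h n ω ≠ 0 := by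
  rw [ae_all_iff]
  intro n
  have hz : complexNormal {0} = 0 := by
    have hF : Measurable fun x : ℝ => if x = 0 then (1 : ℝ≥0∞) else 0 :=
      Measurable.ite (measurableSet_singleton 0) measurable_const measurable_const
    have h1 := lintegral_complexNormal hF
    have h2 : ∫⁻ r in Ioi (0 : ℝ), ENNReal.ofReal (2 * r * Real.exp (-r ^ 2)) *
        (if r ^ 2 = 0 then (1 : ℝ≥0∞) else 0) = 0 := by
      rw [setLIntegral_congr_fun measurableSet_Ioi (g := fun _ => 0), lintegral_zero]
      intro r hr
      have : r ≠ 0 := ne_of_gt hr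
      simp [this]
    rw [h2] at h1
    rw [← h1, ← lintegral_indicator_one (measurableSet_singleton 0)]
    refine lintegral_congr fun z => ?_
    by_cases hz : z = 0 <;> simp [hz]
  rw [← hnet.fading_law n, Measure.map_apply (hnet.fading_measurable n)
    (measurableSet_singleton 0)] at hz
  exact measure_mono_null (fun ω hω => not_not.1 hω) hz

/-- Every group almost surely has infinitely many stations, hence one other than `b`, and its
received power is almost surely positive. -/
lemma ae_interference_ne_zero (hnet : IsNetwork P lam X grp h) (α : ℝ) :
    ∀ᵐ ω ∂P, ∀ b, interference α (fun n => X n ω) (fun n => grp n ω) (fun n => h n ω) b ≠ 0 := by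
  have := hnet.grp_iIndep.isProbabilityMeasure
  filter_upwards [hnet.ae_frequently_grp, hnet.ae_fading_ne_zero, hnet.position_ppp.ae_ne_zero]
    with ω h1 h2 h3 b hb
  obtain ⟨n, hn, hng⟩ := (frequently_atTop.1 (h1 (grp b ω))) (b + 1)
  rw [interference, ENNReal.tsum_eq_zero] at hb
  have := hb n
  rw [if_pos ⟨by omega, hng⟩, ENNReal.ofReal_eq_zero] at this
  have h4 : 0 < ‖X n ω‖ ^ (-α) := Real.rpow_pos_of_pos (norm_pos_iff.2 (h3 n)) _
  have h5 : 0 < ‖h n ω‖ := norm_pos_iff.2 (h2 n)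
  have : 0 < ‖X n ω‖ ^ (-α) * ‖h n ω‖ ^ 2 := by positivity
  linarith

variable {L : ℕ}

/-- The bridge from the serving station to the events computed above. At `T = 0` the cover event
just records the serving group. The exceptional null set is independent of `m` and `T`. -/
lemma ae_serving (hnet : IsNetwork P lam X grp h) (hlam : 0 < lam) {q : Fin L → ℕ} {l : Fin L}
    (hM : 0 < M) (hq : q l ≤ M) (α : ℝ) :
    ∀ᵐ ω ∂P, ∀ m,
      (servingGroup q l (fun n => X n ω) (fun n => grp n ω) = m ↔
        ((fun n => X n ω), (fun n => grp n ω), fun n => h n ω) ∈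
          groupCover (accessGroups M q l) m 0 α) ∧
      ∀ T > 0, (servingGroup q l (fun n => X n ω) (fun n => grp n ω) = m ∧
        T ≤ sir α (fun n => X n ω) (fun n => grp n ω) (fun n => h n ω)
          (servingBS q l (fun n => X n ω) fun n => grp n ω) ↔
        ((fun n => X n ω), (fun n => grp n ω), fun n => h n ω) ∈
          groupCover (accessGroups M q l) m T α) := by
  have := hnet.grp_iIndep.isProbabilityMeasure
  filter_upwards [hnet.ae_exists_nearest hlam (accessGroups_nonempty hM q l hq),
    hnet.ae_interference_ne_zero α, hnet.position_ppp.ae_ne_zero] with ω h1 h2 h3 m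
  obtain ⟨b, hb, hlt⟩ := h1
  have hserv : servingBS q l (fun n => X n ω) (fun n => grp n ω) = b := servingBS_eq hb hlt
  have hgrp : servingGroup q l (fun n => X n ω) (fun n => grp n ω) = grp b ω := by
    rw [servingGroup, hserv]
  have hmem : ∀ T : ℝ, ((fun n => X n ω), (fun n => grp n ω), fun n => h n ω) ∈
      groupCover (accessGroups M q l) m T α ↔
      grp b ω = m ∧ ∑' n, (if n = b then 0 else ENNReal.ofReal
        ((if grp n ω = m then T * (‖X b ω‖ ^ α * ‖X n ω‖ ^ (-α)) else 0) * ‖h n ω‖ ^ 2)) ≤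
        ENNReal.ofReal (‖h b ω‖ ^ 2) := by
    intro T
    constructor
    · rintro ⟨hm, b', ⟨h4, h5⟩, h6⟩
      simp only at h4 h5 h6
      have hbb : b' = b := by
        by_contra hne
        exact h5 b (Ne.symm hne) ⟨hb, (hlt b' hne (h4 ▸ hm)).le⟩
      subst hbb
      exact ⟨h4, h6⟩
    · rintro ⟨h4, h5⟩
      exact ⟨h4 ▸ hb, b, ⟨h4, fun n hn hnA => absurd hnA.2 (not_le.2 (hlt n hn hnA.1))⟩, h5⟩
  refine ⟨?_, fun T hT => ?_⟩
  · rw [hgrp, hmem]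
    simp
  · rw [hgrp, hserv, hmem]
    refine and_congr_right fun hm => ?_
    rw [le_sir_iff hT (h3 b) (h2 b), hm]

end IsNetwork

/-! ### Decoupling of traffic and network -/

section Coverage

variable {Ω : Type*} [MeasurableSpace Ω] {P : Measure Ω} {lam : ℝ} {L M : ℕ} {q : Fin L → ℕ}
  {X : ℕ → Ω → Plane} {grp : ℕ → Ω → Fin M} {h : ℕ → Ω → ℂ}
  {K : Ω → Fin L → ℕ} {L₀ : Ω → Fin L} {J : Ω → ℕ}

lemma IsNetwork.measurable_network (hnet : IsNetwork P lam X grp h) :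
    Measurable fun ω => ((fun n => X n ω), (fun n => grp n ω), fun n => h n ω) :=
  (measurable_pi_iff.2 hnet.position_ppp.measurable).prodMk
    ((measurable_pi_iff.2 hnet.grp_measurable).prodMk (measurable_pi_iff.2 hnet.fading_measurable))

/-- The request is independent of the network, so its probability cancels and the ratio is that of
`1 / (|A| + β)` to `1 / |A|`; it is the same for all groups of `A`. -/
lemma measure_groupCover_inter (hnet : IsNetwork P lam X grp h) (hlam : 0 < lam)
    (hdec : IsDecoupled P q X grp h K L₀ J) (A : Finset (Fin M)) (m : Fin M) {T α : ℝ}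
    (hT : 0 ≤ T) (hα : 2 < α) (l : Fin L) :
    P {ω | ((fun n => X n ω), (fun n => grp n ω), fun n => h n ω) ∈ groupCover A m T α ∧
        L₀ ω = l} =
      ENNReal.ofReal (A.card / (A.card + 2 * tailIntegral T α)) *
        P {ω | ((fun n => X n ω), (fun n => grp n ω), fun n => h n ω) ∈ groupCover A m 0 α ∧
          L₀ ω = l} := by
  by_cases hm : m ∈ A
  · have hind : ∀ T, P {ω | ((fun n => X n ω), (fun n => grp n ω), fun n => h n ω) ∈
        groupCover A m T α ∧ L₀ ω = l} =
        P {ω | ((fun n => X n ω), (fun n => grp n ω), fun n => h n ω) ∈ groupCover A m T α} *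
          P {ω | L₀ ω = l} := fun T =>
      hdec.request_indep.measure_inter_preimage_eq_mul _ {l} (measurableSet_groupCover A m T α)
        (measurableSet_singleton l)
    have hA : (0 : ℝ) < A.card := by exact_mod_cast Finset.card_pos.2 ⟨m, hm⟩
    have htail := tailIntegral_nonneg hT α
    rw [hind, hind, groupCover_of_mem hm, groupCover_of_mem hm,
      hnet.measure_iUnion_coverEvent hlam hm hT hα,
      hnet.measure_iUnion_coverEvent hlam hm le_rfl hα, tailIntegral_zero, ← mul_assoc,
      ← ENNReal.ofReal_mul (by positivity)]
    congr 2
    field_simp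
    ring
  · simp [groupCover_of_notMem hm]

/-- Given the group of the serving base station and the traffic, the signal-to-interference ratio
exceeds `T` with the same probability as for the network alone. -/
lemma measure_traffic_coverage [IsProbabilityMeasure P] (hnet : IsNetwork P lam X grp h)
    (hlam : 0 < lam) (hM : 0 < M) (hdec : IsDecoupled P q X grp h K L₀ J)
    {T α : ℝ} (hT : 0 ≤ T) (hα : 2 < α) (m : Fin M) (l : Fin L) (hq : q l ≤ M) (k : Fin L → ℕ)
    (j : ℕ) :
    P {ω | ((fun n => X n ω), (fun n => grp n ω), fun n => h n ω) ∈
        groupCover (accessGroups M q l) m T α ∧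
        servingGroup q (L₀ ω) (fun n => X n ω) (fun n => grp n ω) = m ∧ L₀ ω = l ∧
        K ω = k ∧ J ω = j} =
      ENNReal.ofReal ((accessGroups M q l).card /
        ((accessGroups M q l).card + 2 * tailIntegral T α)) *
      P {ω | servingGroup q (L₀ ω) (fun n => X n ω) (fun n => grp n ω) = m ∧ L₀ ω = l ∧
        K ω = k ∧ J ω = j} := by
  set A := accessGroups M q l with hA
  have hserv := hnet.ae_serving hlam (l := l) hM hq α
  have hsub : ∀ p, p ∈ groupCover A m T α → p ∈ groupCover A m 0 α := by
    rintro p ⟨hm, b, hb, -⟩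
    exact ⟨hm, b, hb, by simp⟩
  have h1 : P {ω | ((fun n => X n ω), (fun n => grp n ω), fun n => h n ω) ∈ groupCover A m T α ∧
        servingGroup q (L₀ ω) (fun n => X n ω) (fun n => grp n ω) = m ∧ L₀ ω = l} =
      P {ω | ((fun n => X n ω), (fun n => grp n ω), fun n => h n ω) ∈ groupCover A m T α ∧
        L₀ ω = l} := by
    refine measure_congr (eventuallyEq_set.2 ?_)
    filter_upwards [hserv] with ω hω
    constructor
    · rintro ⟨h1, -, h3⟩
      exact ⟨h1, h3⟩
    · rintro ⟨h1, h3⟩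
      refine ⟨h1, ?_, h3⟩
      rw [h3]
      exact (hω m).1.2 (hsub _ h1)
  have h2 : P {ω | servingGroup q (L₀ ω) (fun n => X n ω) (fun n => grp n ω) = m ∧ L₀ ω = l} =
      P {ω | ((fun n => X n ω), (fun n => grp n ω), fun n => h n ω) ∈ groupCover A m 0 α ∧
        L₀ ω = l} := by
    refine measure_congr (eventuallyEq_set.2 ?_)
    filter_upwards [hserv] with ω hω
    constructor
    · rintro ⟨h1, h3⟩
      rw [h3] at h1
      exact ⟨(hω m).1.1 h1, h3⟩
    · rintro ⟨h1, h3⟩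
      refine ⟨?_, h3⟩
      rw [h3]
      exact (hω m).1.2 h1
  -- Conditional independence comes in product form, so the probability of serving group and request
  -- must be cancelled; if it vanishes, both sides of the goal are zero.
  have key := hdec.traffic_condIndep _ (measurableSet_groupCover A m T α) m l k j
  rw [h1, measure_groupCover_inter hnet hlam hdec A m hT hα l, ← h2] at key
  by_cases h0 : P {ω | servingGroup q (L₀ ω) (fun n => X n ω) (fun n => grp n ω) = m ∧
      L₀ ω = l} = 0
  · have hH : P {ω | servingGroup q (L₀ ω) (fun n => X n ω) (fun n => grp n ω) = m ∧ L₀ ω = l ∧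
        K ω = k ∧ J ω = j} = 0 := by
      refine measure_mono_null ?_ h0
      exact fun ω hω => ⟨hω.1, hω.2.1⟩
    rw [hH, mul_zero]
    exact measure_mono_null (fun ω hω => hω.2) hH
  · rw [mul_right_comm] at key
    exact (ENNReal.mul_left_inj h0 (measure_ne_top _ _)).1 key

end Coverage

end CachedNetwork

end

/-! ### The conditional coverage probability -/

theorem lemma1 {Ω : Type*} [MeasurableSpace Ω] (P : Measure Ω) [IsProbabilityMeasure P]
    {L M : ℕ} (hM : 0 < M) (q : Fin L → ℕ) (hq : ∀ l, q l ≤ M) (BB : ℕ)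
    (lam W τ α : ℝ) (hlam : 0 < lam) (hW : 0 < W) (hτ : 0 < τ) (hα : 2 < α)
    (X : ℕ → Ω → CachedNetwork.Plane) (grp : ℕ → Ω → Fin M) (h : ℕ → Ω → ℂ)
    (hnet : CachedNetwork.IsNetwork P lam X grp h)
    (K : Ω → Fin L → ℕ) (L₀ : Ω → Fin L) (J : Ω → ℕ)
    (htraffic : CachedNetwork.IsTraffic P q K L₀ J)
    (hdec : CachedNetwork.IsDecoupled P q X grp h K L₀ J)
    (k : Fin L → ℕ) (l₀ : Fin L)
    (hpos : P {ω | K ω = k ∧ L₀ ω = l₀ ∧ CachedNetwork.IsScheduled q BB (L₀ ω) (J ω)} ≠ 0) :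
    (P[|{ω | K ω = k ∧ L₀ ω = l₀ ∧ CachedNetwork.IsScheduled q BB (L₀ ω) (J ω)}]).real
        {ω | τ ≤ CachedNetwork.achievableRate q BB W α (K ω) (L₀ ω)
          (fun n => X n ω) (fun n => grp n ω) (fun n => h n ω)} =
      (CachedNetwork.accessDensity lam M q l₀ / CachedNetwork.interfererDensity lam M) /
        (CachedNetwork.accessDensity lam M q l₀ / CachedNetwork.interfererDensity lam M +
          CachedNetwork.betaCoeff W τ α M (CachedNetwork.servedUsers q BB k)) := by
  open CachedNetwork Set Filter in
  have hMr : (0 : ℝ) < M := by exact_mod_cast hM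
  -- The conditioning event has positive probability, so it contains a sample in which the typical
  -- user is counted. Hence `g₀ > 0`, which gives `T > 0` and keeps the rate from being a division
  -- by zero.
  have hk : 0 < servedUsers q BB k := by
    have hex : ∃ ω, (K ω = k ∧ L₀ ω = l₀ ∧ IsScheduled q BB (L₀ ω) (J ω)) ∧ 1 ≤ K ω (L₀ ω) := by
      by_contra hno
      push Not at hno
      refine hpos (measure_mono_null (fun ω hω => ?_) htraffic.user_counted)
      exact not_le.2 (hno ω hω)
    obtain ⟨ω, ⟨h1, h2, h3⟩, h4⟩ := hex
    rw [h2] at h3 h4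
    rw [h1] at h4
    exact servedUsers_pos h4 h3
  have hkr : (0 : ℝ) < servedUsers q BB k := by exact_mod_cast hk
  have he : 0 < (M : ℝ) * servedUsers q BB k * τ / W := by positivity
  rw [accessDensity_div_interfererDensity hM q l₀ (hq l₀) hlam,
    betaCoeff_eq (by linarith) he]
  set T := (2 : ℝ) ^ ((M : ℝ) * servedUsers q BB k * τ / W) - 1 with hTdef
  have hT : 0 < T := sub_pos.2 (Real.one_lt_rpow (by norm_num) he)
  set A := accessGroups M q l₀ with hA
  set ρ := (A.card : ℝ) / (A.card + 2 * tailIntegral T α) with hρ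
  have hρ0 : 0 ≤ ρ := by
    have := tailIntegral_nonneg hT.le α
    positivity
  set D := {ω | K ω = k ∧ L₀ ω = l₀ ∧ IsScheduled q BB (L₀ ω) (J ω)} with hD
  have hKm : ∀ k, MeasurableSet {ω | K ω = k} :=
    fun k => htraffic.loading_measurable (measurableSet_singleton k)
  have hLm : ∀ l, MeasurableSet {ω | L₀ ω = l} :=
    fun l => htraffic.request_measurable (measurableSet_singleton l)
  have hJm : ∀ j, MeasurableSet {ω | J ω = j} :=
    fun j => htraffic.rank_measurable (measurableSet_singleton j)
  have hDm : MeasurableSet D := by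
    refine (hKm k).inter ((hLm l₀).inter ?_)
    exact (htraffic.request_measurable.prodMk htraffic.rank_measurable)
      (MeasurableSet.of_discrete (s := {p : Fin L × ℕ | IsScheduled q BB p.1 p.2}))
  have hserv := hnet.ae_serving hlam (l := l₀) hM (hq l₀) α
  set net := fun ω => ((fun n => X n ω), (fun n => grp n ω), fun n => h n ω) with hnetdef
  set S : Fin M → Ω → Prop := fun m ω =>
    servingGroup q (L₀ ω) (fun n => X n ω) (fun n => grp n ω) = m with hS
  -- The conditioning event is split by serving group and backhaul rank; unscheduled ranks give
  -- empty pieces.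
  set H : Fin M × ℕ → Set Ω := fun p =>
    {ω | (S p.1 ω ∧ L₀ ω = l₀ ∧ K ω = k ∧ J ω = p.2) ∧ IsScheduled q BB l₀ p.2} with hH
  set G : Fin M × ℕ → Set Ω := fun p => {ω | net ω ∈ groupCover A p.1 T α} ∩ H p with hG
  -- The serving group agrees almost surely with the measurable cover event at `T = 0`, which gives
  -- null measurability without showing `servingBS` measurable.
  have hHm : ∀ p, NullMeasurableSet (H p) P := by
    intro p
    have hms : MeasurableSet {ω | (net ω ∈ groupCover A p.1 0 α ∧ L₀ ω = l₀ ∧ K ω = k ∧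
        J ω = p.2) ∧ IsScheduled q BB l₀ p.2} :=
      ((hnet.measurable_network (measurableSet_groupCover A p.1 0 α)).inter
        ((hLm l₀).inter ((hKm k).inter (hJm p.2)))).inter (MeasurableSet.const _)
    refine hms.nullMeasurableSet.congr (eventuallyEq_set.2 ?_)
    filter_upwards [hserv] with ω hω
    refine and_congr_left fun _ => ?_
    constructor
    · rintro ⟨h1, h2, h3⟩
      refine ⟨?_, h2, h3⟩
      simp only [hS, h2]
      exact (hω p.1).1.2 h1
    · rintro ⟨h1, h2, h3⟩
      refine ⟨?_, h2, h3⟩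
      simp only [hS, h2] at h1
      exact (hω p.1).1.1 h1
  have hGm : ∀ p, NullMeasurableSet (G p) P := fun p =>
    (hnet.measurable_network (measurableSet_groupCover A p.1 T α)).nullMeasurableSet.inter (hHm p)
  have hHd : Pairwise (Function.onFun Disjoint H) := by
    intro p p' hpp
    rw [Function.onFun, Set.disjoint_left]
    rintro ω ⟨⟨h1, -, -, h2⟩, -⟩ ⟨⟨h3, -, -, h4⟩, -⟩
    exact hpp (Prod.ext (h1.symm.trans h3) (h2.symm.trans h4))
  have hGd : Pairwise (Function.onFun Disjoint G) := fun p p' hpp =>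
    (hHd hpp).mono inter_subset_right inter_subset_right
  -- The factor is the same for every group and rank, so it comes out of the sum over pieces and
  -- survives the conditioning.
  have hGH : ∀ p, P (G p) = ENNReal.ofReal ρ * P (H p) := by
    intro p
    by_cases hs : IsScheduled q BB l₀ p.2
    · have := measure_traffic_coverage hnet hlam hM hdec hT.le hα p.1 l₀
        (hq l₀) k p.2
      have e1 : H p = {ω | S p.1 ω ∧ L₀ ω = l₀ ∧ K ω = k ∧ J ω = p.2} := by
        ext ω; exact and_iff_left hs
      change P ({ω | net ω ∈ groupCover A p.1 T α} ∩ H p) = _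
      rw [e1]
      exact this
    · have e1 : H p = ∅ := by
        ext ω
        simp only [mem_empty_iff_false, iff_false]
        exact fun hω => hs hω.2
      simp only [hG, e1, inter_empty, measure_empty, mul_zero]
  have hDu : D = ⋃ p, H p := by
    ext ω
    rw [mem_iUnion]
    constructor
    · rintro ⟨h1, h2, h3⟩
      exact ⟨(_, J ω), ⟨rfl, h2, h1, rfl⟩, h2 ▸ h3⟩
    · rintro ⟨p, ⟨-, h2, h3, h4⟩, h5⟩
      refine ⟨h3, h2, ?_⟩
      rw [h2, h4]
      exact h5
  have hDR : P (D ∩ {ω | τ ≤ achievableRate q BB W α (K ω) (L₀ ω)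
      (fun n => X n ω) (fun n => grp n ω) (fun n => h n ω)}) = P (⋃ p, G p) := by
    refine measure_congr (eventuallyEq_set.2 ?_)
    filter_upwards [hserv] with ω hω
    have hrate : ω ∈ D → (τ ≤ achievableRate q BB W α (K ω) (L₀ ω) (fun n => X n ω)
        (fun n => grp n ω) (fun n => h n ω) ↔ T ≤ sir α (fun n => X n ω) (fun n => grp n ω)
          (fun n => h n ω) (servingBS q l₀ (fun n => X n ω) fun n => grp n ω)) := by
      rintro ⟨h1, h2, -⟩
      rw [h1, h2]
      exact le_achievableRate_iff hM q BB α hW k hk l₀ _ _ _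
    have hmem : ω ∈ ⋃ p, G p ↔ ω ∈ D ∧ ∃ p, ω ∈ G p := by
      rw [mem_iUnion, hDu, mem_iUnion]
      exact ⟨fun ⟨p, hp⟩ => ⟨⟨p, hp.2⟩, p, hp⟩, fun hp => hp.2⟩
    rw [hmem, mem_inter_iff]
    refine and_congr_right fun hωD => ?_
    rw [mem_ofPred_eq, hrate hωD]
    constructor
    · intro hle
      have hωU := hωD
      rw [hDu, mem_iUnion] at hωU
      obtain ⟨p, hp⟩ := hωU
      refine ⟨p, ?_, hp⟩
      have h1 := hp.1.1
      simp only [hS, hp.1.2.1] at h1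
      exact ((hω p.1).2 T hT).1 ⟨h1, hle⟩
    · rintro ⟨p, hp, -⟩
      exact (((hω p.1).2 T hT).2 hp).2
  rw [measureReal_def, cond_apply hDm, hDR, measure_iUnion₀ (hGd.mono fun _ _ h => h.aedisjoint) hGm]
  simp_rw [hGH]
  rw [ENNReal.tsum_mul_left, ← measure_iUnion₀ (hHd.mono fun _ _ h => h.aedisjoint) hHm, ← hDu,
    mul_left_comm, ENNReal.inv_mul_cancel hpos (measure_ne_top _ _), mul_one,
    ENNReal.toReal_ofReal hρ0]
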